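/- Let $\tau\in i\mathbb R_{>0}$, $p=e^{2\pi i\tau}$, and let $\eta\in\mathbb C$ be real or purely imaginary. Let $$\theta(x)=\theta_1(x|\tau)=ip^{1/8}e^{-\pi ix}\prod_{j\ge 0}(1-p^{j+1})(1-e^{2\pi ix}p^j)(1-e^{-2\pi ix}p^{j+1}),\qquad p^{1/8}=e^{\pi i\tau/4},$$ $[x]=\theta(2\eta x)$, $[x]_k=[x][x+1]\cdots[x+k-1]$ and $[x_1,\dots,x_n]_k=[x_1]_k\cdots[x_n]_k$. For an integer $N\ge 0$ and $0\le k\le N$ put $$e_k^N(x;a,b)=\prod_{j=0}^{k-1}\theta(a+x+2j\eta)\theta(a-x+2j\eta)\prod_{j=0}^{N-k-1}\theta(b+x+2j\eta)\theta(b-x+2j\eta).$$ Call $(a,b)\in\mathbb C^2$ admissible if $a-b+2j\eta\notin\mathbb Z+\tau\mathbb Z$ for $j=1-N,\dots,N-1$ and $a+b+2j\eta\notin\mathbb Z+\tau\mathbb Z$ for $j=0,\dots,N-1$. Let $(a,b)$ and $(c,d)$ be admissible. Then there are unique coefficients $R_k^l(a,b,c,d;N)$ with $$e_k^N(x;a,b)=\sum_{l=0}^N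 R_k^l(a,b,c,d;N)\,e_l^N(x;c,d)\quad\text{for all }x\in\mathbb C,\qquad 0\le k\le N,$$ and likewise unique coefficients $R_l^k(\eta(1-N)-d,\eta(1-N)-c,\eta(1-N)-b,\eta(1-N)-a;N)$. With $\lambda=(c-d-2N\eta)/2\eta$ and $\mu=(a-b-2N\eta)/2\eta$, put $$F_{kl}=\frac{[\mu+1,(a+b)/2\eta]_N}{[\lambda+1,(c+d)/2\eta]_N}\,\frac{[\lambda+2l]}{[\lambda]}\,\frac{[-N,\lambda]_l}{[1,\lambda+N+1]_l}\,\frac{[\mu]}{[\mu+2k]}\,\frac{[1,\mu+N+1]_k}{[-N,\mu]_k}.$$ Then, for $0\le k,l\le N$, $$R_k^l(a,b,c,d;N)=F_{kl}\;R_l^k\big(\eta(1-N)-d,\ \eta(1-N)-c,\ \eta(1-N)-b,\ \eta(1-N)-a;\ N\big)$$ whenever $\eta\neq 0$ and none of the denominators in $F_{kl}$ vanishes. Moreover, if $\eta\in\mathbb R$ with $|\eta|<\frac1{2(N+1)}$ or $\eta\in i\mathbb R$ with $|\eta|<\frac{\tau/i}{2(N+1)}$, the identity holds for all admissible $(a,b)$,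 $(c,d)$ and all $0\le k,l\le N$, where, if $\eta=0$ or a denominator vanishes, $F_{kl}$ is interpreted as its limit, which exists, as $(\eta',a',b',c',d')\to(\eta,a,b,c,d)$ in $\mathbb C^5$ through the points with $\eta'\ne0$ and nonvanishing denominators (such points accumulate at every point of $\mathbb C^5$). -/

import Mathlib

open Filter Topology

noncomputable section

namespace EllipticSixJ

/-- The infinite shifted factorial `(a; p)_∞ = ∏_{j ≥ 0} (1 - a p ^ j)`. -/
def qPoch (a p : ℂ) : ℂ := ∏' j : ℕ, (1 - a * p ^ j)

/-- Jacobi's theta function `θ(x) = θ₁(x | τ)` in product form,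
`i p^{1/8} e^{-π i x} (p, e^{2π i x}, p e^{-2π i x}; p)_∞` with `p = e^{2π i τ}`. -/
def theta (τ x : ℂ) : ℂ :=
  let p : ℂ := Complex.exp (2 * Real.pi * Complex.I * τ)
  Complex.I * Complex.exp (Real.pi * Complex.I * τ / 4) * Complex.exp (-(Real.pi * Complex.I * x))
    * (qPoch p p * qPoch (Complex.exp (2 * Real.pi * Complex.I * x)) p
        * qPoch (p * Complex.exp (-(2 * Real.pi * Complex.I * x))) p)

/-- The period lattice `ℤ + τℤ`. -/
def lattice (τ : ℂ) : Set ℂ := {z | ∃ m n : ℤ, z = m + n * τ}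

/-- The number `[x] = θ(2ηx)`. -/
def br (τ η x : ℂ) : ℂ := theta τ (2 * η * x)

/-- The elliptic shifted factorial `[x]_k = [x][x+1]⋯[x+k-1]`. -/
def sf (τ η x : ℂ) (k : ℕ) : ℂ := ∏ j ∈ Finset.range k, br τ η (x + j)

/-- `e_k^N(x; a, b) = ∏_{j<k} θ(a ± x + 2jη) ∏_{j<N-k} θ(b ± x + 2jη)`. -/
def e (τ η : ℂ) (N : ℕ) (a b : ℂ) (k : Fin (N + 1)) (x : ℂ) : ℂ :=
  (∏ j ∈ Finset.range (k : ℕ),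
      theta τ (a + x + 2 * j * η) * theta τ (a - x + 2 * j * η)) *
  (∏ j ∈ Finset.range (N - (k : ℕ)),
      theta τ (b + x + 2 * j * η) * theta τ (b - x + 2 * j * η))

/-- The conditions on `(a, b)` under which the functions `e_k^N(x; a, b)`, `0 ≤ k ≤ N`, form a
basis of the space of even theta functions of order `2N`. -/
def BasisCondition (τ η : ℂ) (N : ℕ) (a b : ℂ) : Prop :=
  (∀ j : ℤ, 1 - (N : ℤ) ≤ j → j ≤ (N : ℤ) - 1 → a - b + 2 * j * η ∉ lattice τ) ∧
  (∀ j : ℕ, j < N → a + b + 2 * j * η ∉ lattice τ)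

/-- `r` is a vector of coefficients of `e_k^N(x; a, b)` with respect to the functions
`e_l^N(x; c, d)`. -/
def IsExpansion (τ η : ℂ) (N : ℕ) (a b c d : ℂ) (k : Fin (N + 1)) (r : Fin (N + 1) → ℂ) : Prop :=
  ∀ x : ℂ, e τ η N a b k x = ∑ l : Fin (N + 1), r l * e τ η N c d l x

open Classical in
/-- The connection coefficients `R_k^l(a, b, c, d; N)`, defined by
`e_k^N(x; a, b) = ∑_l R_k^l e_l^N(x; c, d)` (and set to `0` if there is no such expansion). -/
def R (τ η : ℂ) (N : ℕ) (a b c d : ℂ) (k l : Fin (N + 1)) : ℂ :=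
  if h : ∃ r, IsExpansion τ η N a b c d k r then h.choose l else 0

/-- `R_N`: the real `η` with `|η| < 1 / (2(N+1))`. -/
def realRange (N : ℕ) : Set ℂ := {η | η.im = 0 ∧ ‖η‖ < 1 / (2 * ((N : ℝ) + 1))}

/-- `I_N`: the purely imaginary `η` with `|η| < (τ/i) / (2(N+1))`. -/
def imagRange (τ : ℂ) (N : ℕ) : Set ℂ := {η | η.re = 0 ∧ ‖η‖ < τ.im / (2 * ((N : ℝ) + 1))}

/-- `λ = (c - d - 2Nη) / 2η`; the same formula with `(a, b)` in place of `(c, d)` gives `μ`. -/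
def spec (η : ℂ) (N : ℕ) (c d : ℂ) : ℂ := (c - d - 2 * N * η) / (2 * η)

/-- The explicit factor of the self-duality relation. -/
def dualFactor (τ : ℂ) (N : ℕ) (k l : ℕ) (η a b c d : ℂ) : ℂ :=
  let lam := spec η N c d
  let mu := spec η N a b
  (sf τ η (mu + 1) N * sf τ η ((a + b) / (2 * η)) N)
      / (sf τ η (lam + 1) N * sf τ η ((c + d) / (2 * η)) N)
    * (br τ η (lam + 2 * l) / br τ η lam)
    * ((sf τ η (-(N : ℂ)) l * sf τ η lam l) / (sf τ η 1 l * sf τ η (lam + N + 1) l))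
    * (br τ η mu / br τ η (mu + 2 * k))
    * ((sf τ η 1 k * sf τ η (mu + N + 1) k) / (sf τ η (-(N : ℂ)) k * sf τ η mu k))

/-- The product of all the denominators in `dualFactor`. -/
def dualDenominator (τ : ℂ) (N : ℕ) (k l : ℕ) (η a b c d : ℂ) : ℂ :=
  let lam := spec η N c d
  let mu := spec η N a b
  (sf τ η (lam + 1) N * sf τ η ((c + d) / (2 * η)) N) * br τ η lam
    * (sf τ η 1 l * sf τ η (lam + N + 1) l) * br τ η (mu + 2 * k)
    * (sf τ η (-(N : ℂ)) k * sf τ η mu k)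

/-- The set of parameters `(η, a, b, c, d)` for which the formula for `dualFactor` is literally
meaningful: no denominator in it vanishes. -/
def regularSet (τ : ℂ) (N : ℕ) (k l : ℕ) : Set (ℂ × ℂ × ℂ × ℂ × ℂ) :=
  {P | P.1 ≠ 0 ∧ dualDenominator τ N k l P.1 P.2.1 P.2.2.1 P.2.2.2.1 P.2.2.2.2 ≠ 0}

end EllipticSixJ

end

open Filter Topology

noncomputable section

namespace EllipticSixJ

open Finset.HasAntidiagonal (antidiagonal mem_antidiagonal)

open Finset in
lemma sum_antidiagonal_split (n : ℕ) (h f g : ℕ → ℕ → ℂ)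
    (hh : ∀ k l, k + l = n + 1 → h k l = f k l + g k l)
    (hf : f 0 (n + 1) = 0) (hg : g (n + 1) 0 = 0) :
    ∑ q ∈ antidiagonal (n + 1), h q.1 q.2
      = ∑ q ∈ antidiagonal n, (f (q.1 + 1) q.2 + g q.1 (q.2 + 1)) := by
  rw [sum_congr rfl fun q hq => hh q.1 q.2 (mem_antidiagonal.1 hq), sum_add_distrib,
    sum_add_distrib, Nat.sum_antidiagonal_succ (f := fun q => f q.1 q.2),
    Nat.sum_antidiagonal_succ' (f := fun q => g q.1 q.2), hf, hg, zero_add, zero_add]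

/-- The finite shifted factorial `(p; p)_n`. -/
def qFact (p : ℂ) (n : ℕ) : ℂ := ∏ j ∈ Finset.range n, (1 - p ^ (j + 1))

lemma qFact_succ (p : ℂ) (n : ℕ) : qFact p (n + 1) = qFact p n * (1 - p ^ (n + 1)) :=
  Finset.prod_range_succ _ _

lemma one_sub_pow_ne_zero {p : ℂ} (hp : ‖p‖ < 1) (n : ℕ) : 1 - p ^ (n + 1) ≠ 0 := by
  intro h
  have h1 : ‖p ^ (n + 1)‖ < 1 := by
    rw [norm_pow]; exact pow_lt_one₀ (norm_nonneg _) hp (Nat.succ_ne_zero _)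
  rw [← sub_eq_zero.1 h] at h1
  simp at h1

lemma qFact_ne_zero {p : ℂ} (hp : ‖p‖ < 1) (n : ℕ) : qFact p n ≠ 0 :=
  Finset.prod_ne_zero_iff.2 fun _ _ => one_sub_pow_ne_zero hp _

open Finset in
/-- The `q`-binomial theorem. -/
theorem prod_one_add_mul_pow {p : ℂ} (hp : ‖p‖ < 1) (x : ℂ) (n : ℕ) :
    ∏ j ∈ range n, (1 + x * p ^ j) = ∑ q ∈ antidiagonal n,
      qFact p n / (qFact p q.1 * qFact p q.2) * p ^ (q.1.choose 2) * x ^ q.1 := by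
  induction n with
  | zero => simp [qFact]
  | succ n ih =>
    rw [prod_range_succ, ih, sum_mul, sum_antidiagonal_split n
      (fun k l => qFact p (n + 1) / (qFact p k * qFact p l) * p ^ (k.choose 2) * x ^ k)
      (fun k l => qFact p n / (qFact p k * qFact p l) * (1 - p ^ k) * p ^ l
        * p ^ (k.choose 2) * x ^ k)
      (fun k l => qFact p n / (qFact p k * qFact p l) * (1 - p ^ l) * p ^ (k.choose 2) * x ^ k)]
    · refine sum_congr rfl fun q hq => ?_
      obtain ⟨k, l⟩ := q
      rw [HasAntidiagonal.mem_antidiagonal] at hq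
      subst hq
      have h1 := qFact_ne_zero hp k
      have h2 := qFact_ne_zero hp l
      have h3 := one_sub_pow_ne_zero hp k
      have h4 := one_sub_pow_ne_zero hp l
      have h5 : (k + 1).choose 2 = k + k.choose 2 := by
        rw [Nat.choose_succ_succ' k 1, Nat.choose_one_right]
      simp only [qFact_succ, h5, pow_add p k (k.choose 2), pow_add p k l]
      field_simp
      ring
    · intro k l hkl
      rw [qFact_succ, ← hkl, pow_add]
      ring
    · simp
    · simp

lemma summable_norm_mul_pow {p : ℂ} (hp : ‖p‖ < 1) (a : ℂ) :
    Summable fun j : ℕ => ‖-(a * p ^ j)‖ := by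
  simp only [norm_neg, norm_mul, norm_pow]
  exact (summable_geometric_of_lt_one (norm_nonneg _) hp).mul_left _

lemma multipliable_qPoch {p : ℂ} (hp : ‖p‖ < 1) (a : ℂ) :
    Multipliable fun j : ℕ => 1 - a * p ^ j := by
  simpa only [sub_eq_add_neg] using multipliable_one_add_of_summable (summable_norm_mul_pow hp a)

lemma qPoch_ne_zero {p a : ℂ} (hp : ‖p‖ < 1) (ha : ∀ j : ℕ, a * p ^ j ≠ 1) : qPoch a p ≠ 0 := by
  have := tprod_one_add_ne_zero_of_summable (f := fun j : ℕ => -(a * p ^ j))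
    (fun j h => ha j (by linear_combination -h)) (summable_norm_mul_pow hp a)
  simpa only [qPoch, sub_eq_add_neg] using this

lemma qPoch_self_ne_zero {p : ℂ} (hp : ‖p‖ < 1) : qPoch p p ≠ 0 :=
  qPoch_ne_zero hp fun j h => one_sub_pow_ne_zero hp j (by rw [pow_succ', h, sub_self])

lemma continuous_qPoch {p : ℂ} (hp : ‖p‖ < 1) : Continuous fun a => qPoch a p := by
  rw [continuous_iff_continuousAt]
  intro a
  have := tendsto_tprod_one_add_of_dominated_convergence (𝓕 := 𝓝 a)
    (f := fun (a : ℂ) (j : ℕ) => -(a * p ^ j)) (g := fun j => -(a * p ^ j))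
    (bound := fun j => (‖a‖ + 1) * ‖p‖ ^ j)
    ((summable_geometric_of_lt_one (norm_nonneg _) hp).mul_left _)
    (fun j => (by fun_prop : Continuous fun a : ℂ => -(a * p ^ j)).tendsto a) ?_
  · simpa only [ContinuousAt, qPoch, sub_eq_add_neg] using this
  · have : ∀ᶠ b in 𝓝 a, ‖b‖ < ‖a‖ + 1 :=
      continuous_norm.continuousAt.eventually_lt_const (by simp)
    filter_upwards [this] with b hb j
    rw [norm_neg, norm_mul, norm_pow]
    gcongr

lemma tendsto_prod_qPoch {p : ℂ} (hp : ‖p‖ < 1) (a : ℂ) :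
    Tendsto (fun n => ∏ j ∈ Finset.range n, (1 - a * p ^ j)) atTop (𝓝 (qPoch a p)) :=
  (multipliable_qPoch hp a).tendsto_prod_tprod_nat

lemma tendsto_qFact {p : ℂ} (hp : ‖p‖ < 1) : Tendsto (qFact p) atTop (𝓝 (qPoch p p)) := by
  have := tendsto_prod_qPoch hp p
  simp only [← pow_succ'] at this
  exact this

/-- The coefficient of `w ^ r` in the symmetric finite form of the triple product. -/
def tripleCoeff (p : ℂ) (n : ℕ) (r : ℤ) : ℂ :=
  if r.natAbs ≤ n then qFact p (2 * n) / (qFact p (n + r).toNat * qFact p (n - r).toNat) else 0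

lemma exists_tripleCoeff_bound {p : ℂ} (hp : ‖p‖ < 1) : ∃ C : ℝ, ∀ n r, ‖tripleCoeff p n r‖ ≤ C := by
  obtain ⟨C₁, hC₁⟩ := (tendsto_qFact hp).norm.bddAbove_range
  obtain ⟨C₂, hC₂⟩ := ((tendsto_qFact hp).inv₀ (qPoch_self_ne_zero hp)).norm.bddAbove_range
  have h1 : ∀ n, ‖qFact p n‖ ≤ C₁ := fun n => hC₁ ⟨n, rfl⟩
  have h2 : ∀ n, ‖(qFact p n)⁻¹‖ ≤ C₂ := fun n => hC₂ ⟨n, rfl⟩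
  have h1' : 0 ≤ C₁ := (norm_nonneg _).trans (h1 0)
  have h2' : 0 ≤ C₂ := (norm_nonneg _).trans (h2 0)
  refine ⟨C₁ * (C₂ * C₂), fun n r => ?_⟩
  rw [tripleCoeff]
  split_ifs
  · rw [div_eq_mul_inv, mul_inv, norm_mul, norm_mul]
    exact mul_le_mul (h1 _) (mul_le_mul (h2 _) (h2 _) (norm_nonneg _) h2') (by positivity) h1'
  · rw [norm_zero]; positivity

lemma tendsto_tripleCoeff {p : ℂ} (hp : ‖p‖ < 1) (r : ℤ) :
    Tendsto (fun n => tripleCoeff p n r) atTop (𝓝 (qPoch p p)⁻¹) := by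
  have h0 := qPoch_self_ne_zero hp
  have ha : Tendsto (fun n : ℕ => 2 * n) atTop atTop := tendsto_id.const_mul_atTop' (by norm_num)
  have hb : ∀ r : ℤ, Tendsto (fun n : ℕ => ((n : ℤ) + r).toNat) atTop atTop := fun r =>
    tendsto_atTop.2 fun m => by
      filter_upwards [eventually_ge_atTop (m + r.natAbs)] with n hn
      omega
  have := ((tendsto_qFact hp).comp ha).div
    (((tendsto_qFact hp).comp (hb r)).mul ((tendsto_qFact hp).comp (hb (-r)))) (mul_ne_zero h0 h0)
  rw [show qPoch p p / (qPoch p p * qPoch p p) = (qPoch p p)⁻¹ by field_simp] at this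
  refine this.congr' ?_
  filter_upwards [eventually_ge_atTop r.natAbs] with n hn
  simp [tripleCoeff, hn, sub_eq_add_neg]

open Complex in
lemma finite_triple_product {τ : ℂ} (hτ : ‖cexp (2 * Real.pi * I * τ)‖ < 1) (x : ℂ) (n : ℕ) :
    (∏ j ∈ Finset.range n, (1 - cexp (2 * Real.pi * I * x) * cexp (2 * Real.pi * I * τ) ^ j))
      * ∏ j ∈ Finset.range n, (1 - cexp (2 * Real.pi * I * τ) * cexp (-(2 * Real.pi * I * x))
          * cexp (2 * Real.pi * I * τ) ^ j)
    = ∑ r ∈ Finset.Icc (-(n : ℤ)) n, tripleCoeff (cexp (2 * Real.pi * I * τ)) n r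
        * jacobiTheta₂_term r (x + 1 / 2 - τ / 2) τ := by
  set p := cexp (2 * Real.pi * I * τ) with hp
  set w := cexp (2 * Real.pi * I * x) with hw
  have hp0 : p ≠ 0 := exp_ne_zero _
  have hw0 : w ≠ 0 := exp_ne_zero _
  have hwi : cexp (-(2 * Real.pi * I * x)) = w⁻¹ := exp_neg _
  have hpe : ∀ k : ℕ, p ^ k = cexp (k * (2 * Real.pi * I * τ)) := fun k => (exp_nat_mul _ k).symm
  have hwe : -w = cexp (Real.pi * I + 2 * Real.pi * I * x) := by
    rw [exp_add, exp_pi_mul_I, hw]; ring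
  set X := -w * (p ^ n)⁻¹ with hX
  set c := ∏ j ∈ Finset.range n, (-w * (p ^ (j + 1))⁻¹) with hc
  have hc0 : c ≠ 0 := Finset.prod_ne_zero_iff.2 fun j _ =>
    mul_ne_zero (neg_ne_zero.2 hw0) (inv_ne_zero (pow_ne_zero _ hp0))
  have h1 : ∏ j ∈ Finset.range (2 * n), (1 + X * p ^ j)
      = c * ((∏ j ∈ Finset.range n, (1 - w * p ^ j))
        * ∏ j ∈ Finset.range n, (1 - p * cexp (-(2 * Real.pi * I * x)) * p ^ j)) := by
    have e1 : ∏ j ∈ Finset.range n, (1 + X * p ^ j)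
        = c * ∏ j ∈ Finset.range n, (1 - p * cexp (-(2 * Real.pi * I * x)) * p ^ j) := by
      rw [← Finset.prod_range_reflect, hc, ← Finset.prod_mul_distrib]
      refine Finset.prod_congr rfl fun j hj => ?_
      have hj' : n = (n - 1 - j) + (j + 1) := by have := Finset.mem_range.1 hj; omega
      have : p ^ n = p ^ (n - 1 - j) * p ^ (j + 1) := by rw [← pow_add, ← hj']
      rw [hX, this, hwi, pow_succ]
      field_simp
      ring
    have e2 : ∏ j ∈ Finset.range n, (1 + X * p ^ (n + j))
        = ∏ j ∈ Finset.range n, (1 - w * p ^ j) := by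
      refine Finset.prod_congr rfl fun j _ => ?_
      rw [hX, pow_add]
      field_simp
      ring
    rw [two_mul, Finset.prod_range_add, e1, e2]
    ring
  have h2 : ∀ n : ℕ, ∏ j ∈ Finset.range n, (-w * (p ^ (j + 1))⁻¹)
      = cexp (n * (Real.pi * I + 2 * Real.pi * I * x) - Real.pi * I * τ * (n * (n + 1))) := by
    intro n
    induction n with
    | zero => simp
    | succ n ih =>
      rw [Finset.prod_range_succ, ih, hwe, hpe, ← exp_neg, ← exp_add, ← exp_add]
      congr 1
      push_cast
      ring
  have h3 : ∀ k : ℕ, p ^ (k.choose 2) * X ^ k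
      = c * jacobiTheta₂_term ((k : ℤ) - n) (x + 1 / 2 - τ / 2) τ := by
    intro k
    rw [hX, hc, h2, hwe, hpe, hpe, ← exp_neg, ← exp_add, ← exp_nat_mul, ← exp_add,
      jacobiTheta₂_term, ← exp_add, Nat.cast_choose_two]
    have : (k : ℂ) * (Real.pi * I + 2 * Real.pi * I * x + -(n * (2 * Real.pi * I * τ)))
        + (k * (k - 1) / 2) * (2 * Real.pi * I * τ)
        = (n * (Real.pi * I + 2 * Real.pi * I * x) - Real.pi * I * τ * (n * (n + 1)))
        + (2 * Real.pi * I * ((k : ℂ) - n) * (x + 1 / 2 - τ / 2)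
          + Real.pi * I * ((k : ℂ) - n) ^ 2 * τ) := by ring
    push_cast
    rw [← this]
    congr 1
    ring
  apply mul_left_cancel₀ hc0
  rw [← h1, prod_one_add_mul_pow hτ, Finset.mul_sum]
  refine Finset.sum_nbij' (fun q => (q.1 : ℤ) - n)
    (fun r => ((n + r).toNat, (n - r).toNat)) ?_ ?_ ?_ ?_ ?_
  · rintro ⟨k, l⟩ hkl
    simp only [Finset.HasAntidiagonal.mem_antidiagonal, Finset.mem_Icc] at *
    omega
  · intro r hr
    simp only [Finset.HasAntidiagonal.mem_antidiagonal, Finset.mem_Icc] at *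
    omega
  · rintro ⟨k, l⟩ hkl
    simp only [Finset.HasAntidiagonal.mem_antidiagonal, Prod.mk.injEq] at *
    omega
  · intro r hr
    simp only [Finset.mem_Icc] at *
    omega
  · rintro ⟨k, l⟩ hkl
    simp only [Finset.HasAntidiagonal.mem_antidiagonal] at *
    rw [mul_assoc, h3, tripleCoeff, if_pos (by omega),
      show ((n : ℤ) + (k - n)).toNat = k by omega, show ((n : ℤ) - (k - n)).toNat = l by omega]
    ring

open Complex in
lemma norm_nome_lt_one {τ : ℂ} (hτ : 0 < τ.im) : ‖cexp (2 * Real.pi * I * τ)‖ < 1 := by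
  rw [norm_exp, Real.exp_lt_one_iff]
  have : (2 * Real.pi * I * τ).re = -(2 * Real.pi * τ.im) := by simp
  rw [this, neg_lt_zero]
  positivity

open Complex in
/-- Jacobi's triple product identity. -/
theorem theta_eq_jacobiTheta₂ {τ : ℂ} (hτ : 0 < τ.im) (x : ℂ) :
    theta τ x = I * cexp (Real.pi * I * τ / 4) * cexp (-(Real.pi * I * x))
      * jacobiTheta₂ (x + 1 / 2 - τ / 2) τ := by
  have hp := norm_nome_lt_one hτ
  set p := cexp (2 * Real.pi * I * τ) with hpdef
  obtain ⟨C, hC⟩ := exists_tripleCoeff_bound hp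
  have hsum := (hasSum_jacobiTheta₂_term (x + 1 / 2 - τ / 2) hτ).summable.norm
  have h1 : Tendsto (fun n : ℕ => ∑' r : ℤ, tripleCoeff p n r
        * jacobiTheta₂_term r (x + 1 / 2 - τ / 2) τ) atTop
      (𝓝 (∑' r : ℤ, (qPoch p p)⁻¹ * jacobiTheta₂_term r (x + 1 / 2 - τ / 2) τ)) := by
    refine tendsto_tsum_of_dominated_convergence (hsum.mul_left C)
      (fun r => (tendsto_tripleCoeff hp r).mul_const _) (Eventually.of_forall fun n r => ?_)
    rw [norm_mul]
    exact mul_le_mul_of_nonneg_right (hC _ _) (norm_nonneg _)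
  have h2 := (tendsto_prod_qPoch hp (cexp (2 * Real.pi * I * x))).mul
    (tendsto_prod_qPoch hp (p * cexp (-(2 * Real.pi * I * x))))
  have h3 : ∀ n : ℕ, ∑' r : ℤ, tripleCoeff p n r * jacobiTheta₂_term r (x + 1 / 2 - τ / 2) τ
      = (∏ j ∈ Finset.range n, (1 - cexp (2 * Real.pi * I * x) * p ^ j))
      * ∏ j ∈ Finset.range n, (1 - p * cexp (-(2 * Real.pi * I * x)) * p ^ j) := by
    intro n
    rw [finite_triple_product hp]
    refine tsum_eq_sum fun r hr => ?_
    rw [tripleCoeff, if_neg, zero_mul]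
    rw [Finset.mem_Icc] at hr
    omega
  simp only [h3] at h1
  have h4 := tendsto_nhds_unique h2 h1
  rw [tsum_mul_left] at h4
  rw [theta]
  simp only [← hpdef]
  rw [mul_assoc (qPoch p p), h4, mul_inv_cancel_left₀ (qPoch_self_ne_zero hp), jacobiTheta₂]

open Complex in
/-- The quadratic relation splitting a product of theta functions into theta functions of
doubled period. -/
lemma jacobiTheta₂_add_mul_sub {τ : ℂ} (hτ : 0 < τ.im) (u v : ℂ) :
    jacobiTheta₂ (u + v) τ * jacobiTheta₂ (u - v) τ
      = jacobiTheta₂ (2 * u) (2 * τ) * jacobiTheta₂ (2 * v) (2 * τ)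
        + cexp (2 * Real.pi * I * (u + v) + Real.pi * I * τ)
          * (jacobiTheta₂ (2 * u + τ) (2 * τ) * jacobiTheta₂ (2 * v + τ) (2 * τ)) := by
  have hτ2 : 0 < (2 * τ).im := by simpa using hτ
  let φ : (ℤ × ℤ) ⊕ (ℤ × ℤ) → ℤ × ℤ :=
    Sum.elim (fun q => (q.1 + q.2, q.1 - q.2)) (fun q => (q.1 + q.2 + 1, q.1 - q.2))
  have hφ : Function.Bijective φ := by
    constructor
    · rintro (⟨a, b⟩ | ⟨a, b⟩) (⟨c, d⟩ | ⟨c, d⟩) h <;>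
        simp only [φ, Sum.elim_inl, Sum.elim_inr, Prod.mk.injEq, Sum.inl.injEq, Sum.inr.injEq,
          reduceCtorEq] at * <;> omega
    · rintro ⟨m, n⟩
      rcases Int.emod_two_eq_zero_or_one (m + n) with h | h
      · refine ⟨Sum.inl ((m + n) / 2, (m - n) / 2), ?_⟩
        simp only [φ, Sum.elim_inl, Prod.mk.injEq]
        omega
      · refine ⟨Sum.inr ((m + n - 1) / 2, (m - n - 1) / 2), ?_⟩
        simp only [φ, Sum.elim_inr, Prod.mk.injEq]
        omega
  have hs : ∀ z : ℂ, ∀ {σ : ℂ}, 0 < σ.im → Summable fun n => ‖jacobiTheta₂_term n z σ‖ :=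
    fun z _ hσ => (hasSum_jacobiTheta₂_term z hσ).summable.norm
  have hsum : ∀ z z' : ℂ, ∀ {σ : ℂ}, 0 < σ.im → HasSum
      (fun q : ℤ × ℤ => jacobiTheta₂_term q.1 z σ * jacobiTheta₂_term q.2 z' σ)
      (jacobiTheta₂ z σ * jacobiTheta₂ z' σ) := fun z z' σ hσ => by
    rw [jacobiTheta₂, jacobiTheta₂, tsum_mul_tsum_of_summable_norm (hs z hσ) (hs z' hσ)]
    exact (summable_mul_of_summable_norm (hs z hσ) (hs z' hσ)).hasSum
  have h1 := (Equiv.hasSum_iff (Equiv.ofBijective φ hφ)).2 (hsum (u + v) (u - v) hτ)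
  have h2 : HasSum ((fun q : ℤ × ℤ => jacobiTheta₂_term q.1 (u + v) τ
      * jacobiTheta₂_term q.2 (u - v) τ) ∘ (Equiv.ofBijective φ hφ)) _ :=
    HasSum.sum (a := jacobiTheta₂ (2 * u) (2 * τ) * jacobiTheta₂ (2 * v) (2 * τ))
      (b := cexp (2 * Real.pi * I * (u + v) + Real.pi * I * τ)
          * (jacobiTheta₂ (2 * u + τ) (2 * τ) * jacobiTheta₂ (2 * v + τ) (2 * τ))) ?_ ?_
  · exact h1.unique h2
  · convert hsum (2 * u) (2 * v) hτ2 using 1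
    funext q
    simp only [φ, Function.comp, Equiv.ofBijective_apply, Sum.elim_inl, jacobiTheta₂_term,
      ← exp_add]
    congr 1
    push_cast
    ring
  · have h := (hsum (2 * u + τ) (2 * v + τ) hτ2).mul_left
      (cexp (2 * Real.pi * I * (u + v) + Real.pi * I * τ))
    refine Eq.mp (congrArg (fun f => HasSum f _) (funext fun q => ?_)) h
    simp only [φ, Function.comp, Equiv.ofBijective_apply, Sum.elim_inr, jacobiTheta₂_term,
      ← exp_add]
    congr 1
    push_cast
    ring

open Complex in
/-- The addition formula: `θ(x + y) θ(x - y)` is an alternating form in two functions. -/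
theorem exists_theta_add_mul_theta_sub {τ : ℂ} (hτ : 0 < τ.im) :
    ∃ A B : ℂ → ℂ, ∀ x y, theta τ (x + y) * theta τ (x - y) = B x * A y - A x * B y := by
  set c : ℂ := I * cexp (Real.pi * I * τ / 4) with hc
  refine ⟨fun x => c * jacobiTheta₂ (2 * x) (2 * τ),
    fun x => c * cexp (2 * Real.pi * I * x) * jacobiTheta₂ (2 * x + τ) (2 * τ), fun x y => ?_⟩
  have h := jacobiTheta₂_add_mul_sub hτ (x + 1 / 2 - τ / 2) y
  have e1 : jacobiTheta₂ (2 * (x + 1 / 2 - τ / 2)) (2 * τ)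
      = cexp (4 * Real.pi * I * x) * jacobiTheta₂ (2 * x + τ) (2 * τ) := by
    have h1 := jacobiTheta₂_add_left (2 * x - τ) (2 * τ)
    have h2 := jacobiTheta₂_add_left' (2 * x - τ) (2 * τ)
    rw [show 2 * (x + 1 / 2 - τ / 2) = 2 * x - τ + 1 by ring, h1,
      show 2 * x + τ = 2 * x - τ + 2 * τ by ring, h2, ← mul_assoc, ← exp_add]
    rw [show 4 * Real.pi * I * x + -Real.pi * I * (2 * τ + 2 * (2 * x - τ)) = 0 by ring,
      exp_zero, one_mul]
  have e2 : jacobiTheta₂ (2 * (x + 1 / 2 - τ / 2) + τ) (2 * τ) = jacobiTheta₂ (2 * x) (2 * τ) := by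
    rw [show 2 * (x + 1 / 2 - τ / 2) + τ = 2 * x + 1 by ring, jacobiTheta₂_add_left]
  have e3 : cexp (2 * Real.pi * I * (x + 1 / 2 - τ / 2 + y) + Real.pi * I * τ)
      = -(cexp (2 * Real.pi * I * x) * cexp (2 * Real.pi * I * y)) := by
    rw [show 2 * Real.pi * I * (x + 1 / 2 - τ / 2 + y) + Real.pi * I * τ
      = 2 * Real.pi * I * x + 2 * Real.pi * I * y + Real.pi * I by ring, exp_add, exp_add,
      exp_pi_mul_I]
    ring
  have e4 : cexp (-(Real.pi * I * (x + y))) * cexp (-(Real.pi * I * (x - y)))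
      = (cexp (2 * Real.pi * I * x))⁻¹ := by
    rw [← exp_add, ← exp_neg]
    congr 1
    ring
  have e5 : cexp (4 * Real.pi * I * x) = cexp (2 * Real.pi * I * x) ^ 2 := by
    rw [← exp_nat_mul]
    congr 1
    push_cast
    ring
  have e6 := exp_ne_zero (2 * Real.pi * I * x)
  rw [e1, e2, e3, e5] at h
  rw [theta_eq_jacobiTheta₂ hτ, theta_eq_jacobiTheta₂ hτ,
    show x + y + 1 / 2 - τ / 2 = x + 1 / 2 - τ / 2 + y by ring,
    show x - y + 1 / 2 - τ / 2 = x + 1 / 2 - τ / 2 - y by ring, ← hc]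
  calc _ = c * c * (cexp (-(Real.pi * I * (x + y))) * cexp (-(Real.pi * I * (x - y))))
        * (jacobiTheta₂ (x + 1 / 2 - τ / 2 + y) τ * jacobiTheta₂ (x + 1 / 2 - τ / 2 - y) τ) := by
        ring
    _ = _ := by
      rw [h, e4]
      field_simp
      ring

open Complex in
lemma differentiable_theta {τ : ℂ} (hτ : 0 < τ.im) : Differentiable ℂ (theta τ) := by
  have h : Differentiable ℂ fun z => jacobiTheta₂ z τ := fun z => differentiableAt_jacobiTheta₂_fst z hτ
  rw [funext (theta_eq_jacobiTheta₂ hτ)]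
  exact (by fun_prop : Differentiable ℂ fun x => I * cexp (Real.pi * I * τ / 4)
    * cexp (-(Real.pi * I * x))).mul (h.comp (by fun_prop))

lemma continuous_theta {τ : ℂ} (hτ : 0 < τ.im) : Continuous (theta τ) :=
  (differentiable_theta hτ).continuous

open Complex in
lemma theta_neg {τ : ℂ} (hτ : 0 < τ.im) (x : ℂ) : theta τ (-x) = -theta τ x := by
  rw [theta_eq_jacobiTheta₂ hτ, theta_eq_jacobiTheta₂ hτ, ← jacobiTheta₂_neg_left,
    ← jacobiTheta₂_add_left (x + 1 / 2 - τ / 2),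
    show x + 1 / 2 - τ / 2 + 1 = (-(-x + 1 / 2 - τ / 2) + 1 + 1) - τ by ring]
  have h := jacobiTheta₂_add_left' (-(-x + 1 / 2 - τ / 2) + 1 + 1 - τ) τ
  rw [sub_add_cancel, jacobiTheta₂_add_left, jacobiTheta₂_add_left] at h
  rw [h]
  have : cexp (-(Real.pi * I * -x))
      * cexp (-Real.pi * I * (τ + 2 * (-(-x + 1 / 2 - τ / 2) + 1 + 1 - τ)))
      = -cexp (-(Real.pi * I * x)) := by
    rw [← exp_add, show -(Real.pi * I * -x)
      + -Real.pi * I * (τ + 2 * (-(-x + 1 / 2 - τ / 2) + 1 + 1 - τ))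
      = -(Real.pi * I * x) + (Real.pi * I) + (-(2 : ℤ)) * (2 * Real.pi * I) by push_cast; ring,
      exp_add, exp_add, exp_pi_mul_I, ← Int.cast_neg, exp_int_mul_two_pi_mul_I]
    ring
  linear_combination (I * cexp (Real.pi * I * τ / 4)
    * jacobiTheta₂ (-(-x + 1 / 2 - τ / 2) + 1 + 1 - τ) τ) * this

lemma theta_zero {τ : ℂ} (hτ : 0 < τ.im) : theta τ 0 = 0 := by
  have := theta_neg hτ 0
  rw [neg_zero] at this
  linear_combination this / 2

open Complex in
/-- The zeros of the theta function lie in the period lattice. -/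
theorem theta_ne_zero {τ x : ℂ} (hτ : 0 < τ.im) (hx : x ∉ lattice τ) : theta τ x ≠ 0 := by
  have hp := norm_nome_lt_one hτ
  have h2 : (2 * Real.pi * I : ℂ) ≠ 0 := two_pi_I_ne_zero
  refine mul_ne_zero (mul_ne_zero (mul_ne_zero I_ne_zero (exp_ne_zero _)) (exp_ne_zero _))
    (mul_ne_zero (mul_ne_zero (qPoch_self_ne_zero hp) (qPoch_ne_zero hp fun j h => hx ?_))
      (qPoch_ne_zero hp fun j h => hx ?_))
  · rw [← exp_nat_mul, ← exp_add, exp_eq_one_iff] at h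
    obtain ⟨n, hn⟩ := h
    refine ⟨n, -j, mul_left_cancel₀ h2 ?_⟩
    push_cast
    linear_combination hn
  · rw [← exp_nat_mul, ← exp_add, ← exp_add, exp_eq_one_iff] at h
    obtain ⟨n, hn⟩ := h
    refine ⟨-n, j + 1, mul_left_cancel₀ h2 ?_⟩
    push_cast
    linear_combination -hn

lemma countable_lattice (τ : ℂ) : (lattice τ).Countable := by
  refine (Set.countable_range fun q : ℤ × ℤ => (q.1 : ℂ) + q.2 * τ).mono ?_
  rintro z ⟨m, n, rfl⟩
  exact ⟨(m, n), rfl⟩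

lemma dense_theta_ne_zero {τ : ℂ} (hτ : 0 < τ.im) : Dense {x | theta τ x ≠ 0} :=
  ((countable_lattice τ).dense_compl ℂ).mono fun _ hx => theta_ne_zero hτ hx

lemma qPoch_eq_one_sub_mul {p : ℂ} (hp : ‖p‖ < 1) (a : ℂ) :
    qPoch a p = (1 - a) * qPoch (a * p) p := by
  have h1 : Multipliable fun j : ℕ => 1 - a * p ^ (j + 1) := by
    have := multipliable_qPoch hp (a * p)
    simp only [mul_assoc, ← pow_succ'] at this
    exact this
  have h2 := tprod_eq_zero_mul' (f := fun j : ℕ => 1 - a * p ^ j) h1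
  simp only [pow_zero, mul_one] at h2
  rw [qPoch, h2, qPoch]
  simp only [mul_assoc, ← pow_succ']

open Complex in
/-- The theta function with its zero at the origin split off. -/
lemma exists_theta_eq_one_sub_exp_mul {τ : ℂ} (hτ : 0 < τ.im) :
    ∃ g : ℂ → ℂ, Continuous g ∧ g 0 ≠ 0 ∧
      ∀ x, theta τ x = (1 - cexp (2 * Real.pi * I * x)) * g x := by
  have hp := norm_nome_lt_one hτ
  set p := cexp (2 * Real.pi * I * τ) with hpdef
  refine ⟨fun x => I * cexp (Real.pi * I * τ / 4) * cexp (-(Real.pi * I * x))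
      * (qPoch p p * qPoch (cexp (2 * Real.pi * I * x) * p) p
        * qPoch (p * cexp (-(2 * Real.pi * I * x))) p), ?_, ?_, fun x => ?_⟩
  · have h1 : Continuous fun x => qPoch (cexp (2 * Real.pi * I * x) * p) p :=
      (continuous_qPoch hp).comp (f := fun x => cexp (2 * Real.pi * I * x) * p) (by fun_prop)
    have h2 : Continuous fun x => qPoch (p * cexp (-(2 * Real.pi * I * x))) p :=
      (continuous_qPoch hp).comp (f := fun x => p * cexp (-(2 * Real.pi * I * x))) (by fun_prop)
    fun_prop
  · have h := qPoch_self_ne_zero hp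
    simp only [mul_zero, neg_zero, exp_zero, mul_one, one_mul]
    exact mul_ne_zero (mul_ne_zero I_ne_zero (exp_ne_zero _)) (mul_ne_zero (mul_ne_zero h h) h)
  · rw [theta]
    simp only [← hpdef, qPoch_eq_one_sub_mul hp (cexp (2 * Real.pi * I * x))]
    ring

lemma continuous_dslope {f : ℂ → ℂ} (hf : Differentiable ℂ f) (a : ℂ) :
    Continuous (dslope f a) := by
  rw [continuous_iff_continuousAt]
  intro x
  rcases eq_or_ne x a with rfl | hx
  · exact continuousAt_dslope_same.2 (hf _)
  · exact (continuousAt_dslope_of_ne hx).2 (hf x).continuousAt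

open Complex in
/-- The theta function has a simple zero at the origin. -/
theorem exists_theta_eq_mul {τ : ℂ} (hτ : 0 < τ.im) :
    ∃ t : ℂ → ℂ, Continuous t ∧ t 0 ≠ 0 ∧ ∀ x, theta τ x = x * t x := by
  obtain ⟨g, hgc, hg0, hg⟩ := exists_theta_eq_one_sub_exp_mul hτ
  have ht := continuous_dslope (differentiable_theta hτ) 0
  refine ⟨dslope (theta τ) 0, ht, ?_, fun x => ?_⟩
  · have hu : Differentiable ℂ fun x : ℂ => 1 - cexp (2 * Real.pi * I * x) := by fun_prop
    have hu0 : dslope (fun x : ℂ => 1 - cexp (2 * Real.pi * I * x)) 0 0 ≠ 0 := by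
      have h : HasDerivAt (fun x : ℂ => 1 - cexp (2 * Real.pi * I * x))
          (-(2 * Real.pi * I)) 0 := by
        have := ((hasDerivAt_id (0 : ℂ)).const_mul (2 * Real.pi * I : ℂ)).cexp.const_sub 1
        simpa using this
      rw [dslope_same, h.deriv]
      simp
    have heq : dslope (theta τ) 0
        = fun x => dslope (fun x : ℂ => 1 - cexp (2 * Real.pi * I * x)) 0 x * g x := by
      refine Continuous.ext_on (dense_compl_singleton (0 : ℂ)) ht
        ((continuous_dslope hu 0).mul hgc) ?_
      intro x hx
      have hx : x ≠ 0 := hx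
      simp only [dslope_of_ne _ hx, slope_def_field, theta_zero hτ, hg x, mul_zero, exp_zero,
        sub_self, sub_zero]
      ring
    rw [heq]
    exact mul_ne_zero hu0 hg0
  · have := sub_smul_dslope (theta τ) 0 x
    rw [theta_zero hτ, sub_zero, sub_zero, smul_eq_mul] at this
    exact this.symm

/-- The even theta function `x ↦ θ(a + x) θ(a - x)` of order two. -/
def thetaPair (τ a x : ℂ) : ℂ := theta τ (a + x) * theta τ (a - x)

lemma thetaPair_swap {τ : ℂ} (hτ : 0 < τ.im) (a x : ℂ) :
    thetaPair τ a x = -thetaPair τ x a := by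
  rw [thetaPair, thetaPair, ← neg_sub a x, theta_neg hτ, add_comm x a]
  ring

lemma thetaPair_self {τ : ℂ} (hτ : 0 < τ.im) (a : ℂ) : thetaPair τ a a = 0 := by
  rw [thetaPair, sub_self, theta_zero hτ, mul_zero]

/-- Weierstrass' three-term relation. -/
theorem thetaPair_mul_thetaPair {τ : ℂ} (hτ : 0 < τ.im) (u v w x : ℂ) :
    thetaPair τ u x * thetaPair τ v w
      = thetaPair τ u w * thetaPair τ v x - thetaPair τ u v * thetaPair τ w x := by
  obtain ⟨A, B, h⟩ := exists_theta_add_mul_theta_sub hτ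
  simp only [thetaPair, h]
  ring

/-- The function `e_k^{k+l}(x; a, b)`. -/
def thetaBasis (τ η a b : ℂ) (k l : ℕ) (x : ℂ) : ℂ :=
  (∏ j ∈ Finset.range k, thetaPair τ (a + 2 * j * η) x)
    * ∏ j ∈ Finset.range l, thetaPair τ (b + 2 * j * η) x

lemma e_eq_thetaBasis (τ η : ℂ) (N : ℕ) (a b : ℂ) (k : Fin (N + 1)) (x : ℂ) :
    e τ η N a b k x = thetaBasis τ η a b k (N - k) x := by
  simp only [e, thetaBasis, thetaPair, add_right_comm, add_sub_right_comm]

lemma thetaBasis_succ_left (τ η a b : ℂ) (k l : ℕ) (x : ℂ) :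
    thetaBasis τ η a b (k + 1) l x = thetaPair τ (a + 2 * k * η) x * thetaBasis τ η a b k l x := by
  rw [thetaBasis, thetaBasis, Finset.prod_range_succ]
  ring

lemma thetaBasis_succ_right (τ η a b : ℂ) (k l : ℕ) (x : ℂ) :
    thetaBasis τ η a b k (l + 1) x = thetaPair τ (b + 2 * l * η) x * thetaBasis τ η a b k l x := by
  rw [thetaBasis, thetaBasis, Finset.prod_range_succ]
  ring

lemma thetaBasis_succ_right' (τ η a b : ℂ) (k l : ℕ) (x : ℂ) :
    thetaBasis τ η a b k (l + 1) x = thetaPair τ b x * thetaBasis τ η a (b + 2 * η) k l x := by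
  rw [thetaBasis, thetaBasis, Finset.prod_range_succ']
  have : ∀ j : ℕ, b + 2 * η + 2 * j * η = b + 2 * (j + 1 : ℕ) * η := fun j => by push_cast; ring
  simp only [this, Nat.cast_zero, mul_zero, zero_mul, add_zero]
  ring

lemma continuousAt_theta_comp {X : Type*} [TopologicalSpace X] {τ : ℂ} (hτ : 0 < τ.im)
    {f : X → ℂ} {p : X} (hf : ContinuousAt f p) : ContinuousAt (fun y => theta τ (f y)) p :=
  ContinuousAt.comp (g := theta τ) (continuous_theta hτ).continuousAt hf

lemma continuousAt_thetaPair_comp {X : Type*} [TopologicalSpace X] {τ : ℂ} (hτ : 0 < τ.im)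
    {f g : X → ℂ} {p : X} (hf : ContinuousAt f p) (hg : ContinuousAt g p) :
    ContinuousAt (fun y => thetaPair τ (f y) (g y)) p :=
  (continuousAt_theta_comp hτ (hf.add hg)).mul (continuousAt_theta_comp hτ (hf.sub hg))

lemma continuous_thetaBasis {τ : ℂ} (hτ : 0 < τ.im) (η a b : ℂ) (k l : ℕ) :
    Continuous (thetaBasis τ η a b k l) := by
  have h : ∀ a, Continuous (thetaPair τ a) := fun a =>
    continuous_iff_continuousAt.2 fun _ => continuousAt_thetaPair_comp hτ continuousAt_const continuousAt_id
  exact (continuous_finsetProd _ fun _ _ => h _).mul (continuous_finsetProd _ fun _ _ => h _)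

/-- The condition under which the functions `e_k^N(x; a, b)` form a basis, in terms of the
pairs of factors occurring in them. -/
def Nondegenerate (τ η : ℂ) (N : ℕ) (a b : ℂ) : Prop :=
  ∀ k l : ℕ, k + l < N → thetaPair τ (a + 2 * k * η) (b + 2 * l * η) ≠ 0

lemma BasisCondition.nondegenerate {τ η a b : ℂ} {N : ℕ} (hτ : 0 < τ.im)
    (h : BasisCondition τ η N a b) : Nondegenerate τ η N a b := by
  intro k l hkl
  have h1 := theta_ne_zero hτ (h.1 ((k : ℤ) - l) (by omega) (by omega))
  have h2 := theta_ne_zero hτ (h.2 (k + l) hkl)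
  push_cast at h1 h2
  rw [thetaPair, show a + 2 * k * η + (b + 2 * l * η) = a + b + 2 * (k + l) * η by ring,
    show a + 2 * k * η - (b + 2 * l * η) = a - b + 2 * (k - l) * η by ring]
  exact mul_ne_zero h2 h1

lemma Nondegenerate.shift {τ η a b : ℂ} {N : ℕ} (h : Nondegenerate τ η (N + 1) a b) :
    Nondegenerate τ η N a (b + 2 * η) := by
  intro k l hkl
  have := h k (l + 1) (by omega)
  rwa [show b + 2 * ((l + 1 : ℕ) : ℂ) * η = b + 2 * η + 2 * l * η by push_cast; ring] at this

/-- The functions `e_k^N(x; a, b)` are linearly independent. -/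
theorem eq_zero_of_sum_thetaBasis_eq_zero {τ η a : ℂ} (hτ : 0 < τ.im) (N : ℕ) (b : ℂ)
    (hab : Nondegenerate τ η N a b) (r : ℕ → ℕ → ℂ)
    (hr : ∀ x, ∑ q ∈ antidiagonal N, r q.1 q.2 * thetaBasis τ η a b q.1 q.2 x = 0) :
    ∀ k l, k + l = N → r k l = 0 := by
  induction N generalizing b r with
  | zero =>
    intro k l hkl
    obtain ⟨rfl, rfl⟩ : k = 0 ∧ l = 0 := by omega
    simpa [thetaBasis] using hr 0
  | succ N ih =>
    have hr' : ∀ x, r (N + 1) 0 * thetaBasis τ η a b (N + 1) 0 x + thetaPair τ b x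
        * ∑ q ∈ antidiagonal N, r q.1 (q.2 + 1)
          * thetaBasis τ η a (b + 2 * η) q.1 q.2 x = 0 := fun x => by
      rw [← hr x, Finset.Nat.sum_antidiagonal_succ', Finset.mul_sum]
      congr 1
      refine Finset.sum_congr rfl fun q _ => ?_
      rw [thetaBasis_succ_right']
      ring
    have h0 : r (N + 1) 0 = 0 := by
      have h1 := hr' b
      rw [thetaPair_self hτ, zero_mul, add_zero] at h1
      refine (mul_eq_zero.1 h1).resolve_right (mul_ne_zero ?_ (by simp))
      refine Finset.prod_ne_zero_iff.2 fun j hj => ?_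
      simpa using hab j 0 (by simpa using hj)
    have hL : Dense {x | thetaPair τ b x ≠ 0} := by
      have hd : ∀ f : ℂ ≃ₜ ℂ, Dense (f ⁻¹' {x | theta τ x ≠ 0}) := fun f =>
        (dense_theta_ne_zero hτ).preimage f.isOpenMap
      have ho : ∀ f : ℂ ≃ₜ ℂ, IsOpen (f ⁻¹' {x | theta τ x ≠ 0}) := fun f =>
        (isOpen_ne_fun (continuous_theta hτ) continuous_const).preimage f.continuous
      refine ((hd (Homeomorph.addLeft b)).inter_of_isOpen_left
        (hd (Homeomorph.subLeft b)) (ho _)).mono ?_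
      exact fun x hx => mul_ne_zero hx.1 hx.2
    have h1 := ih (b + 2 * η) hab.shift (fun k l => r k (l + 1)) (congrFun
      (Continuous.ext_on hL (continuous_finsetSum _ fun q _ =>
        continuous_const.mul (continuous_thetaBasis hτ _ _ _ _ _)) continuous_const
        fun x hx => (mul_eq_zero.1 (by simpa [h0] using hr' x)).resolve_left hx))
    intro k l hkl
    rcases l with _ | l
    · obtain rfl : k = N + 1 := by omega
      exact h0
    · exact h1 k l (by omega)

/-- The coefficients in the expansion of `∏_{i<n} θ(u_i ± x)` with respect to the functions
`e_k^n(x; c, d)`. -/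
def expansionCoeff (τ η c d : ℂ) (u : ℕ → ℂ) : ℕ → ℕ → ℕ → ℂ
  | 0 => fun _ _ => 1
  | n + 1 => fun k l =>
    (match k with
      | 0 => 0
      | k + 1 => thetaPair τ (u n) (d + 2 * l * η) / thetaPair τ (c + 2 * k * η) (d + 2 * l * η)
          * expansionCoeff τ η c d u n k l)
    + (match l with
      | 0 => 0
      | l + 1 => thetaPair τ (u n) (c + 2 * k * η) / thetaPair τ (d + 2 * l * η) (c + 2 * k * η)
          * expansionCoeff τ η c d u n k l)

theorem prod_thetaPair_eq_sum {τ η c d : ℂ} {N : ℕ} (hτ : 0 < τ.im)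
    (hcd : Nondegenerate τ η N c d) (u : ℕ → ℂ) (n : ℕ) (hn : n ≤ N) (x : ℂ) :
    ∏ i ∈ Finset.range n, thetaPair τ (u i) x
      = ∑ q ∈ antidiagonal n,
          expansionCoeff τ η c d u n q.1 q.2 * thetaBasis τ η c d q.1 q.2 x := by
  have key : ∀ V C D U W T r s : ℂ, V ≠ 0 → U * V = W * C - T * D →
      r * s * U = W / V * r * (C * s) + T / -V * r * (D * s) := by
    intro V C D U W T r s hV h
    field_simp
    linear_combination r * s * h
  induction n with
  | zero => simp [expansionCoeff, thetaBasis]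
  | succ n ih =>
    rw [Finset.prod_range_succ, ih (by omega), Finset.sum_mul, sum_antidiagonal_split n
      (fun k l => expansionCoeff τ η c d u (n + 1) k l * thetaBasis τ η c d k l x)
      (fun k l => (match k with
        | 0 => 0
        | k + 1 => thetaPair τ (u n) (d + 2 * l * η) / thetaPair τ (c + 2 * k * η) (d + 2 * l * η)
          * expansionCoeff τ η c d u n k l) * thetaBasis τ η c d k l x)
      (fun k l => (match l with
        | 0 => 0
        | l + 1 => thetaPair τ (u n) (c + 2 * k * η) / thetaPair τ (d + 2 * l * η) (c + 2 * k * η)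
          * expansionCoeff τ η c d u n k l) * thetaBasis τ η c d k l x)
      (fun k l _ => by rw [expansionCoeff, add_mul]) (by simp) (by simp)]
    refine Finset.sum_congr rfl fun q hq => ?_
    obtain ⟨k, l⟩ := q
    rw [mem_antidiagonal] at hq
    have h1 := hcd k l (by simp only at hq; omega)
    have h2 := thetaPair_mul_thetaPair hτ (u n) (c + 2 * k * η) (d + 2 * l * η) x
    simp only
    rw [thetaBasis_succ_left, thetaBasis_succ_right, thetaPair_swap hτ (d + 2 * l * η)
      (c + 2 * k * η)]
    exact key _ _ _ _ _ _ _ _ h1 h2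

lemma continuousAt_expansionCoeff {X : Type*} [TopologicalSpace X] {τ : ℂ} (hτ : 0 < τ.im)
    {η c d : X → ℂ} {u : X → ℕ → ℂ} {p : X} (hη : ContinuousAt η p) (hc : ContinuousAt c p)
    (hd : ContinuousAt d p) (hu : ∀ i, ContinuousAt (fun y => u y i) p) {N : ℕ}
    (hcd : Nondegenerate τ (η p) N (c p) (d p)) (n k l : ℕ) (hkl : k + l = n) (hn : n ≤ N) :
    ContinuousAt (fun y => expansionCoeff τ (η y) (c y) (d y) (u y) n k l) p := by
  induction n generalizing k l with
  | zero => exact continuousAt_const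
  | succ n ih =>
    simp only [expansionCoeff]
    refine ContinuousAt.add ?_ ?_
    · rcases k with _ | k
      · exact continuousAt_const
      · refine ContinuousAt.mul (ContinuousAt.div ?_ ?_ (hcd k l (by omega)))
          (ih k l (by omega) (by omega))
        · exact continuousAt_thetaPair_comp hτ (hu n) (by fun_prop)
        · exact continuousAt_thetaPair_comp hτ (by fun_prop) (by fun_prop)
    · rcases l with _ | l
      · exact continuousAt_const
      · refine ContinuousAt.mul (ContinuousAt.div ?_ ?_ ?_) (ih k l (by omega) (by omega))
        · exact continuousAt_thetaPair_comp hτ (hu n) (by fun_prop)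
        · exact continuousAt_thetaPair_comp hτ (by fun_prop) (by fun_prop)
        · rw [thetaPair_swap hτ, neg_ne_zero]
          exact hcd k l (by omega)

/-- The zeros of the factors of `e_k^{N}(x; a, b)`. -/
def factorSeq (η a b : ℂ) (k i : ℕ) : ℂ :=
  if i < k then a + 2 * i * η else b + 2 * (i - k : ℕ) * η

lemma prod_factorSeq (τ η a b : ℂ) (k l : ℕ) (x : ℂ) :
    ∏ i ∈ Finset.range (k + l), thetaPair τ (factorSeq η a b k i) x
      = thetaBasis τ η a b k l x := by
  rw [Finset.prod_range_add, thetaBasis]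
  congr 1
  · refine Finset.prod_congr rfl fun j hj => ?_
    rw [factorSeq, if_pos (Finset.mem_range.1 hj)]
  · refine Finset.prod_congr rfl fun j hj => ?_
    rw [factorSeq, if_neg (by omega), Nat.add_sub_cancel_left]

lemma sum_fin_eq_sum_antidiagonal (N : ℕ) (f : ℕ → ℕ → ℂ) :
    ∑ l : Fin (N + 1), f l (N - l) = ∑ q ∈ antidiagonal N, f q.1 q.2 := by
  rw [Finset.Nat.sum_antidiagonal_eq_sum_range_succ, ← Fin.sum_univ_eq_sum_range
    (fun i => f i (N - i))]

lemma isExpansion_expansionCoeff {τ η c d : ℂ} {N : ℕ} (hτ : 0 < τ.im)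
    (hcd : Nondegenerate τ η N c d) (a b : ℂ) (k : Fin (N + 1)) :
    IsExpansion τ η N a b c d k
      fun l => expansionCoeff τ η c d (factorSeq η a b k) N l (N - l) := by
  intro x
  simp only [e_eq_thetaBasis]
  rw [sum_fin_eq_sum_antidiagonal N fun i j => expansionCoeff τ η c d (factorSeq η a b k) N i j
    * thetaBasis τ η c d i j x, ← prod_thetaPair_eq_sum hτ hcd _ N le_rfl, ← prod_factorSeq,
    Nat.add_sub_cancel' (Nat.lt_succ_iff.1 k.2)]

lemma eq_zero_of_sum_e_eq_zero {τ η a b : ℂ} {N : ℕ} (hτ : 0 < τ.im)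
    (hab : Nondegenerate τ η N a b) {r : Fin (N + 1) → ℂ}
    (hr : ∀ x, ∑ l, r l * e τ η N a b l x = 0) : r = 0 := by
  have h := eq_zero_of_sum_thetaBasis_eq_zero hτ N b hab (fun k _ => r (Fin.ofNat (N + 1) k))
    fun x => by
      rw [← hr x, ← sum_fin_eq_sum_antidiagonal N fun i j => r (Fin.ofNat (N + 1) i)
        * thetaBasis τ η a b i j x]
      simp [e_eq_thetaBasis]
  funext l
  simpa using h l (N - l) (by omega)

lemma IsExpansion.unique {τ η a b c d : ℂ} {N : ℕ} (hτ : 0 < τ.im)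
    (hcd : Nondegenerate τ η N c d) {k : Fin (N + 1)} {r s : Fin (N + 1) → ℂ}
    (hr : IsExpansion τ η N a b c d k r) (hs : IsExpansion τ η N a b c d k s) : r = s := by
  refine sub_eq_zero.1 (eq_zero_of_sum_e_eq_zero hτ hcd fun x => ?_)
  simp only [Pi.sub_apply, sub_mul, Finset.sum_sub_distrib]
  rw [← hr x, ← hs x, sub_self]

lemma isExpansion_R {τ η c d : ℂ} {N : ℕ} (hτ : 0 < τ.im) (hcd : Nondegenerate τ η N c d)
    (a b : ℂ) (k : Fin (N + 1)) : IsExpansion τ η N a b c d k (R τ η N a b c d k) := by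
  have h : ∃ r, IsExpansion τ η N a b c d k r := ⟨_, isExpansion_expansionCoeff hτ hcd a b k⟩
  have : R τ η N a b c d k = h.choose := funext fun l => by rw [R, dif_pos h]
  rw [this]
  exact h.choose_spec

lemma R_eq_expansionCoeff {τ η c d : ℂ} {N : ℕ} (hτ : 0 < τ.im)
    (hcd : Nondegenerate τ η N c d) (a b : ℂ) (k l : Fin (N + 1)) :
    R τ η N a b c d k l = expansionCoeff τ η c d (factorSeq η a b k) N l (N - l) :=
  congrFun ((isExpansion_R hτ hcd a b k).unique hτ hcd
    (isExpansion_expansionCoeff hτ hcd a b k)) l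

lemma Nondegenerate.eventually {X : Type*} [TopologicalSpace X] {τ : ℂ} (hτ : 0 < τ.im)
    {η a b : X → ℂ} {p : X} (hη : ContinuousAt η p) (ha : ContinuousAt a p)
    (hb : ContinuousAt b p) {N : ℕ} (hab : Nondegenerate τ (η p) N (a p) (b p)) :
    ∀ᶠ y in 𝓝 p, Nondegenerate τ (η y) N (a y) (b y) := by
  have h : ∀ k ∈ Set.Iio N, ∀ l ∈ Set.Iio N, ∀ᶠ y in 𝓝 p, k + l < N →
      thetaPair τ (a y + 2 * k * η y) (b y + 2 * l * η y) ≠ 0 := by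
    intro k _ l _
    by_cases hkl : k + l < N
    · have : ContinuousAt (fun y => thetaPair τ (a y + 2 * k * η y) (b y + 2 * l * η y)) p :=
        continuousAt_thetaPair_comp hτ (by fun_prop) (by fun_prop)
      filter_upwards [this.eventually_ne (hab k l hkl)] with y hy _ using hy
    · exact Eventually.of_forall fun y h => absurd h hkl
  have hfin : (Set.Iio N).Finite := Set.finite_Iio N
  have h' := (eventually_all_finite hfin).2 fun k hk => (eventually_all_finite hfin).2 (h k hk)
  filter_upwards [h'] with y hy k l hkl
  exact hy k (by simp; omega) l (by simp; omega) hkl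

/-- The connection coefficients depend continuously on the parameters. -/
theorem continuousAt_R {X : Type*} [TopologicalSpace X] {τ : ℂ} (hτ : 0 < τ.im)
    {η a b c d : X → ℂ} {p : X} (hη : ContinuousAt η p) (ha : ContinuousAt a p)
    (hb : ContinuousAt b p) (hc : ContinuousAt c p) (hd : ContinuousAt d p) {N : ℕ}
    (hcd : Nondegenerate τ (η p) N (c p) (d p)) (k l : Fin (N + 1)) :
    ContinuousAt (fun y => R τ (η y) N (a y) (b y) (c y) (d y) k l) p := by
  refine ContinuousAt.congr (f := fun y => expansionCoeff τ (η y) (c y) (d y)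
    (factorSeq (η y) (a y) (b y) k) N l (N - l)) ?_ ?_
  · refine continuousAt_expansionCoeff hτ hη hc hd (fun i => ?_) hcd N _ _ (by omega) le_rfl
    unfold factorSeq
    split_ifs <;> fun_prop
  · filter_upwards [Nondegenerate.eventually hτ hη hc hd hcd] with y hy
    exact (R_eq_expansionCoeff hτ hy _ _ k l).symm

/-- The product `θ(y) θ(y + h) ⋯ θ(y + (n-1) h)`. -/
def thetaFact (τ h y : ℂ) (n : ℕ) : ℂ := ∏ j ∈ Finset.range n, theta τ (y + j * h)

lemma thetaFact_zero (τ h y : ℂ) : thetaFact τ h y 0 = 1 := Finset.prod_range_zero _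

lemma thetaFact_succ (τ h y : ℂ) (n : ℕ) :
    thetaFact τ h y (n + 1) = thetaFact τ h y n * theta τ (y + n * h) :=
  Finset.prod_range_succ _ _

lemma thetaFact_succ' (τ h y : ℂ) (n : ℕ) :
    thetaFact τ h y (n + 1) = theta τ y * thetaFact τ h (y + h) n := by
  rw [thetaFact, thetaFact, Finset.prod_range_succ']
  have : ∀ j : ℕ, y + h + j * h = y + (j + 1 : ℕ) * h := fun j => by push_cast; ring
  simp only [this, Nat.cast_zero, zero_mul, add_zero]
  ring

lemma thetaFact_add (τ h y : ℂ) (m n : ℕ) :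
    thetaFact τ h y (m + n) = thetaFact τ h y m * thetaFact τ h (y + m * h) n := by
  have : ∀ j : ℕ, y + m * h + j * h = y + (m + j : ℕ) * h := fun j => by push_cast; ring
  simp only [thetaFact, Finset.prod_range_add, this]

lemma thetaFact_reflect (τ h y : ℂ) (n : ℕ) :
    thetaFact τ h y n = thetaFact τ (-h) (y + (n - 1) * h) n := by
  rw [thetaFact, thetaFact, ← Finset.prod_range_reflect]
  refine Finset.prod_congr rfl fun j hj => ?_
  have : ((n - 1 - j : ℕ) : ℂ) = n - 1 - j := by
    have := Finset.mem_range.1 hj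
    rw [Nat.cast_sub (by omega), Nat.cast_sub (by omega), Nat.cast_one]
  rw [this]
  congr 1
  ring

lemma thetaFact_neg {τ : ℂ} (hτ : 0 < τ.im) (h y : ℂ) (n : ℕ) :
    thetaFact τ (-h) (-y) n = (-1) ^ n * thetaFact τ h y n := by
  have : ∀ j : ℕ, theta τ (-y + j * -h) = -1 * theta τ (y + j * h) := fun j => by
    rw [show -y + j * -h = -(y + j * h) by ring, theta_neg hτ, neg_one_mul]
  simp only [thetaFact, this, Finset.prod_mul_distrib, Finset.prod_const, Finset.card_range]

lemma thetaFact_ne_zero {τ h y : ℂ} {n : ℕ} (H : ∀ j : ℕ, j < n → theta τ (y + j * h) ≠ 0) :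
    thetaFact τ h y n ≠ 0 :=
  Finset.prod_ne_zero_iff.2 fun j hj => H j (Finset.mem_range.1 hj)

/-- The coefficient `h_k` (with `k + l = N`) in the expansion of the kernel
`∏_j θ(y ± x + (2j - N + 1)η)`, with `s` and `m` standing for the sum and the difference of the
two parameters. -/
def kernelCoeff (τ η s m : ℂ) (k l : ℕ) : ℂ :=
  (-1) ^ l * (thetaFact τ (2 * η) (2 * η) (k + l)
      / (thetaFact τ (2 * η) (2 * η) k * thetaFact τ (2 * η) (2 * η) l))
    / thetaFact τ (2 * η) s (k + l)
    * (theta τ (m + 2 * (k - l) * η)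
      / (thetaFact τ (-(2 * η)) m (l + 1) * thetaFact τ (2 * η) (m + 2 * η) k))

lemma thetaPair_add_mul (τ η A B : ℂ) (k l : ℂ) :
    thetaPair τ (A + 2 * k * η) (B + 2 * l * η)
      = theta τ (A + B + 2 * (k + l) * η) * theta τ (A - B + 2 * (k - l) * η) := by
  rw [thetaPair]
  congr 2 <;> ring

lemma theta_three_term {τ : ℂ} (hτ : 0 < τ.im) (η A B z K L : ℂ) :
    theta τ (2 * (K + L) * η) * theta τ (A - B + 2 * (K - L) * η)
        * (theta τ (z + B + 2 * (K + L - 1) * η) * theta τ (z + A + 2 * (K + L - 1) * η))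
      = theta τ (2 * K * η) * theta τ (A - B + 2 * K * η)
          * (theta τ (z + B + 2 * (K + L - 1 + L) * η) * theta τ (z + A + 2 * (K - 1) * η))
        + theta τ (2 * L * η) * theta τ (A - B - 2 * L * η)
          * (theta τ (z + A + 2 * (K + L - 1 + K) * η) * theta τ (z + B + 2 * (L - 1) * η)) := by
  have h := thetaPair_mul_thetaPair hτ ((B - A) / 2) ((B - A) / 2 + 2 * L * η)
    ((B - A) / 2 - 2 * K * η) (z + (A + B) / 2 + 2 * (K + L - 1) * η)
  simp only [thetaPair] at h
  have n1 : theta τ ((B - A) / 2 - (z + (A + B) / 2 + 2 * (K + L - 1) * η))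
      = -theta τ (z + A + 2 * (K + L - 1) * η) := by
    rw [← theta_neg hτ]; congr 1; ring
  have n2 : theta τ ((B - A) / 2 + 2 * L * η + ((B - A) / 2 - 2 * K * η))
      = -theta τ (A - B + 2 * (K - L) * η) := by
    rw [← theta_neg hτ]; congr 1; ring
  have n3 : theta τ ((B - A) / 2 + ((B - A) / 2 - 2 * K * η))
      = -theta τ (A - B + 2 * K * η) := by
    rw [← theta_neg hτ]; congr 1; ring
  have n4 : theta τ ((B - A) / 2 + 2 * L * η - (z + (A + B) / 2 + 2 * (K + L - 1) * η))
      = -theta τ (z + A + 2 * (K - 1) * η) := by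
    rw [← theta_neg hτ]; congr 1; ring
  have n5 : theta τ ((B - A) / 2 + ((B - A) / 2 + 2 * L * η))
      = -theta τ (A - B - 2 * L * η) := by
    rw [← theta_neg hτ]; congr 1; ring
  have n6 : theta τ ((B - A) / 2 - ((B - A) / 2 + 2 * L * η)) = -theta τ (2 * L * η) := by
    rw [← theta_neg hτ]; congr 1; ring
  have n7 : theta τ ((B - A) / 2 - 2 * K * η - (z + (A + B) / 2 + 2 * (K + L - 1) * η))
      = -theta τ (z + A + 2 * (K + L - 1 + K) * η) := by
    rw [← theta_neg hτ]; congr 1; ring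
  rw [n1, n2, n3, n4, n5, n6, n7,
    show (B - A) / 2 + (z + (A + B) / 2 + 2 * (K + L - 1) * η)
      = z + B + 2 * (K + L - 1) * η by ring,
    show (B - A) / 2 + 2 * L * η - ((B - A) / 2 - 2 * K * η) = 2 * (K + L) * η by ring,
    show (B - A) / 2 - ((B - A) / 2 - 2 * K * η) = 2 * K * η by ring,
    show (B - A) / 2 + 2 * L * η + (z + (A + B) / 2 + 2 * (K + L - 1) * η)
      = z + B + 2 * (K + L - 1 + L) * η by ring,
    show (B - A) / 2 - 2 * K * η + (z + (A + B) / 2 + 2 * (K + L - 1) * η)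
      = z + B + 2 * (L - 1) * η by ring] at h
  linear_combination h

/-- No theta function occurring in the formulas for the parameters `(a, b)` with `a + b = s`,
`a - b = m` vanishes. -/
structure Generic (τ η s m : ℂ) : Prop where
  step : ∀ j : ℤ, j ≠ 0 → theta τ (2 * j * η) ≠ 0
  sum : ∀ j : ℤ, theta τ (s + 2 * j * η) ≠ 0
  diff : ∀ j : ℤ, theta τ (m + 2 * j * η) ≠ 0

/-- The elliptic binomial theorem. -/
theorem expansionCoeff_eq {τ η A B : ℂ} (hτ : 0 < τ.im) (hg : Generic τ η (A + B) (A - B))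
    (z : ℂ) (n k l : ℕ) (hn : k + l = n) :
    expansionCoeff τ η A B (fun i => z + 2 * i * η) n k l
      = kernelCoeff τ η (A + B) (A - B) k l
        * (thetaFact τ (2 * η) (z - B) k * thetaFact τ (2 * η) (z + B + 2 * l * η) k
          * (thetaFact τ (2 * η) (z - A) l * thetaFact τ (2 * η) (z + A + 2 * k * η) l)) := by
  have hq : ∀ k : ℕ, theta τ (2 * η + k * (2 * η)) ≠ 0 := fun k => by
    have := hg.step (k + 1) (by omega)
    push_cast at this
    convert this using 2; ring
  have hQ : ∀ k, thetaFact τ (2 * η) (2 * η) k ≠ 0 := fun k => thetaFact_ne_zero fun j _ => hq j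
  have hs : ∀ k : ℕ, theta τ (A + B + k * (2 * η)) ≠ 0 := fun k => by
    convert hg.sum k using 2; push_cast; ring
  have hS : ∀ k, thetaFact τ (2 * η) (A + B) k ≠ 0 := fun k => thetaFact_ne_zero fun j _ => hs j
  have hu : ∀ k : ℕ, theta τ (A - B + k * (-(2 * η))) ≠ 0 := fun k => by
    convert hg.diff (-k) using 2; push_cast; ring
  have hU : ∀ k, thetaFact τ (-(2 * η)) (A - B) k ≠ 0 := fun k => thetaFact_ne_zero fun j _ => hu j
  have hv : ∀ k : ℕ, theta τ (A - B + 2 * η + k * (2 * η)) ≠ 0 := fun k => by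
    convert hg.diff (k + 1) using 2; push_cast; ring
  have hV : ∀ k, thetaFact τ (2 * η) (A - B + 2 * η) k ≠ 0 := fun k =>
    thetaFact_ne_zero fun j _ => hv j
  have hd : ∀ k l : ℕ, theta τ (A - B + 2 * (k - l) * η) ≠ 0 := fun k l => by
    convert hg.diff (k - l) using 2; push_cast; ring
  induction n generalizing k l with
  | zero =>
    obtain ⟨rfl, rfl⟩ : k = 0 ∧ l = 0 := by omega
    have := hu 0
    simp only [Nat.cast_zero, zero_mul, add_zero] at this
    simp [expansionCoeff, kernelCoeff, thetaFact, this]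
  | succ n ih =>
    rcases k with _ | k <;> rcases l with _ | l
    · omega
    · obtain rfl : n = l := by omega
      simp only [expansionCoeff, zero_add]
      rw [ih 0 n (by omega)]
      have e1 : thetaPair τ (z + 2 * n * η) (A + 2 * (0 : ℕ) * η)
          = theta τ (z + A + 2 * (0 : ℕ) * η + n * (2 * η)) * theta τ (z - A + n * (2 * η)) := by
        rw [thetaPair]; congr 2 <;> ring
      have e2 : thetaPair τ (B + 2 * n * η) (A + 2 * (0 : ℕ) * η)
          = -(theta τ (A + B + n * (2 * η)) * theta τ (A - B + 2 * ((0 : ℕ) - n) * η)) := by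
        rw [thetaPair_swap hτ, thetaPair_add_mul]
        congr 3; ring
      rw [e1, e2, kernelCoeff, kernelCoeff, thetaFact_succ _ _ (z - A), zero_add, zero_add,
        thetaFact_succ _ _ (z + A + _), thetaFact_succ _ _ (A + B), thetaFact_succ _ _ _ (n + 1)]
      have e3 : theta τ (A - B + 2 * ((0 : ℕ) - (n + 1 : ℕ)) * η)
          = theta τ (A - B + (n + 1 : ℕ) * (-(2 * η))) := by congr 1; push_cast; ring
      rw [e3]
      simp only [thetaFact_zero]
      have h1 := hd 0 n
      have h2 := hQ n
      have h3 := hQ (n + 1)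
      have h4 := hs n
      have h5 := hS n
      have h6 := hu (n + 1)
      have h7 := hU (n + 1)
      generalize theta τ (A - B + (n + 1 : ℕ) * (-(2 * η))) = t6 at *
      generalize theta τ (A - B + 2 * ((0 : ℕ) - n) * η) = t1 at *
      generalize theta τ (A + B + n * (2 * η)) = t4 at *
      generalize theta τ (z + A + 2 * (0 : ℕ) * η + n * (2 * η)) = y1
      generalize theta τ (z - A + n * (2 * η)) = y2
      generalize thetaFact τ (2 * η) (2 * η) n = t2 at *
      generalize thetaFact τ (2 * η) (2 * η) (n + 1) = t3 at *
      generalize thetaFact τ (2 * η) (A + B) n = t5 at *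
      generalize thetaFact τ (-(2 * η)) (A - B) (n + 1) = t7 at *
      generalize thetaFact τ (2 * η) (z - A) n = y3
      generalize thetaFact τ (2 * η) (z + A + 2 * (0 : ℕ) * η) n = y4
      rw [pow_succ]
      field_simp
    · obtain rfl : n = k := by omega
      simp only [expansionCoeff, add_zero]
      rw [ih n 0 (by omega)]
      have e1 : thetaPair τ (z + 2 * n * η) (B + 2 * (0 : ℕ) * η)
          = theta τ (z + B + 2 * (0 : ℕ) * η + n * (2 * η)) * theta τ (z - B + n * (2 * η)) := by
        rw [thetaPair]; congr 2 <;> ring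
      have e2 : thetaPair τ (A + 2 * n * η) (B + 2 * (0 : ℕ) * η)
          = theta τ (A + B + n * (2 * η)) * theta τ (A - B + 2 * (n - (0 : ℕ)) * η) := by
        rw [thetaPair_add_mul]
        congr 2; push_cast; ring
      rw [e1, e2, kernelCoeff, kernelCoeff, thetaFact_succ _ _ (z - B), add_zero, add_zero,
        thetaFact_succ _ _ (z + B + _), thetaFact_succ _ _ (A + B),
        thetaFact_succ _ _ (A - B + 2 * η)]
      have e3 : theta τ (A - B + 2 * ((n + 1 : ℕ) - (0 : ℕ)) * η)
          = theta τ (A - B + 2 * η + n * (2 * η)) := by congr 1; push_cast; ring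
      rw [e3]
      simp only [thetaFact_zero]
      have h1 := hd n 0
      have h2 := hQ n
      have h3 := hQ (n + 1)
      have h4 := hs n
      have h5 := hS n
      have h6 := hv n
      have h7 := hV n
      have h8 := hU (0 + 1)
      generalize theta τ (A - B + 2 * η + n * (2 * η)) = t6 at *
      generalize theta τ (A - B + 2 * (n - (0 : ℕ)) * η) = t1 at *
      generalize theta τ (A + B + n * (2 * η)) = t4 at *
      generalize theta τ (z + B + 2 * (0 : ℕ) * η + n * (2 * η)) = y1
      generalize theta τ (z - B + n * (2 * η)) = y2
      generalize thetaFact τ (2 * η) (2 * η) n = t2 at *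
      generalize thetaFact τ (2 * η) (2 * η) (n + 1) = t3 at *
      generalize thetaFact τ (2 * η) (A + B) n = t5 at *
      generalize thetaFact τ (-(2 * η)) (A - B) (0 + 1) = t8 at *
      generalize thetaFact τ (2 * η) (A - B + 2 * η) n = t7 at *
      generalize thetaFact τ (2 * η) (z - B) n = y3
      generalize thetaFact τ (2 * η) (z + B + 2 * (0 : ℕ) * η) n = y4
      field_simp
    · have hn' : k + l + 1 = n := by omega
      have hnc : (n : ℂ) = k + l + 1 := by rw [← hn']; push_cast; ring
      simp only [expansionCoeff]
      rw [ih k (l + 1) (by omega), ih (k + 1) l (by omega)]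
      have three := theta_three_term hτ η A B z (k + 1) (l + 1)
      have e1 : thetaPair τ (z + 2 * n * η) (B + 2 * (l + 1 : ℕ) * η)
          = theta τ (z + B + 2 * (k + 1 + (l + 1) - 1 + (l + 1)) * η)
            * theta τ (z - B + k * (2 * η)) := by
        rw [thetaPair, hnc]; congr 2 <;> push_cast <;> ring
      have e2 : thetaPair τ (z + 2 * n * η) (A + 2 * (k + 1 : ℕ) * η)
          = theta τ (z + A + 2 * (k + 1 + (l + 1) - 1 + (k + 1)) * η)
            * theta τ (z - A + l * (2 * η)) := by
        rw [thetaPair, hnc]; congr 2 <;> push_cast <;> ring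
      have e3 : thetaPair τ (A + 2 * k * η) (B + 2 * (l + 1 : ℕ) * η)
          = theta τ (A + B + n * (2 * η)) * theta τ (A - B + 2 * (k - (l + 1 : ℕ)) * η) := by
        rw [thetaPair_add_mul, hnc]
        congr 2; push_cast; ring
      have e4 : thetaPair τ (B + 2 * l * η) (A + 2 * (k + 1 : ℕ) * η)
          = -(theta τ (A + B + n * (2 * η)) * theta τ (A - B + 2 * ((k + 1 : ℕ) - l) * η)) := by
        rw [thetaPair_swap hτ, thetaPair_add_mul, hnc]
        congr 3; push_cast; ring
      have e5 : thetaFact τ (2 * η) (z + B + 2 * l * η) (k + 1)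
          = theta τ (z + B + 2 * (l + 1 - 1) * η)
            * thetaFact τ (2 * η) (z + B + 2 * (l + 1 : ℕ) * η) k := by
        rw [thetaFact_succ']; congr 2 <;> push_cast <;> ring
      have e6 : thetaFact τ (2 * η) (z + B + 2 * (l + 1 : ℕ) * η) (k + 1)
          = theta τ (z + B + 2 * (k + 1 + (l + 1) - 1) * η)
            * thetaFact τ (2 * η) (z + B + 2 * (l + 1 : ℕ) * η) k := by
        rw [thetaFact_succ, mul_comm]; congr 2; push_cast; ring
      have e7 : thetaFact τ (2 * η) (z + A + 2 * k * η) (l + 1)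
          = theta τ (z + A + 2 * (k + 1 - 1) * η)
            * thetaFact τ (2 * η) (z + A + 2 * (k + 1 : ℕ) * η) l := by
        rw [thetaFact_succ']; congr 2 <;> push_cast <;> ring
      have e8 : thetaFact τ (2 * η) (z + A + 2 * (k + 1 : ℕ) * η) (l + 1)
          = theta τ (z + A + 2 * (k + 1 + (l + 1) - 1) * η)
            * thetaFact τ (2 * η) (z + A + 2 * (k + 1 : ℕ) * η) l := by
        rw [thetaFact_succ, mul_comm]; congr 2; push_cast; ring
      have a1 : theta τ (2 * (k + 1 + (l + 1)) * η) = theta τ (2 * η + n * (2 * η)) := by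
        rw [hnc]; congr 1; ring
      have a2 : theta τ (2 * (k + 1) * η) = theta τ (2 * η + k * (2 * η)) := by congr 1; ring
      have a3 : theta τ (2 * (l + 1) * η) = theta τ (2 * η + l * (2 * η)) := by congr 1; ring
      have a4 : theta τ (A - B + 2 * (k + 1) * η) = theta τ (A - B + 2 * η + k * (2 * η)) := by
        congr 1; ring
      have a5 : theta τ (A - B - 2 * (l + 1) * η) = theta τ (A - B + (l + 1 : ℕ) * (-(2 * η))) := by
        congr 1; push_cast; ring
      have a6 : theta τ (A - B + 2 * ((k + 1 : ℕ) - (l + 1 : ℕ)) * η)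
          = theta τ (A - B + 2 * (k + 1 - (l + 1)) * η) := by push_cast; rfl
      rw [a1, a2, a3, a4, a5] at three
      rw [e1, e2, e3, e4, e5, e6, e7, e8, kernelCoeff, kernelCoeff, kernelCoeff, a6,
        show k + 1 + (l + 1) = n + 1 by omega, show k + (l + 1) = n by omega,
        show k + 1 + l = n by omega, thetaFact_succ _ _ (z - B), thetaFact_succ _ _ (z - A),
        thetaFact_succ _ _ (2 * η) n, thetaFact_succ _ _ (2 * η) k, thetaFact_succ _ _ (2 * η) l,
        thetaFact_succ _ _ (A + B), thetaFact_succ _ _ (A - B + 2 * η),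
        thetaFact_succ _ _ (A - B) (l + 1)]
      have h1 := hd k (l + 1)
      have h2 := hd (k + 1) l
      have h3 := hQ k
      have h4 := hQ l
      have h5 := hq k
      have h6 := hq l
      have h7 := hs n
      have h8 := hS n
      have h9 := hv k
      have h10 := hV k
      have h11 := hu (l + 1)
      have h12 := hU (l + 1)
      generalize theta τ (A - B + 2 * (k - (l + 1 : ℕ)) * η) = t1 at *
      generalize theta τ (A - B + 2 * ((k + 1 : ℕ) - l) * η) = t2 at *
      generalize thetaFact τ (2 * η) (2 * η) k = t3 at *
      generalize thetaFact τ (2 * η) (2 * η) l = t4 at *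
      generalize theta τ (2 * η + k * (2 * η)) = t5 at *
      generalize theta τ (2 * η + l * (2 * η)) = t6 at *
      generalize theta τ (A + B + n * (2 * η)) = t7 at *
      generalize thetaFact τ (2 * η) (A + B) n = t8 at *
      generalize theta τ (A - B + 2 * η + k * (2 * η)) = t9 at *
      generalize thetaFact τ (2 * η) (A - B + 2 * η) k = t10 at *
      generalize theta τ (A - B + (l + 1 : ℕ) * (-(2 * η))) = t11 at *
      generalize thetaFact τ (-(2 * η)) (A - B) (l + 1) = t12 at *
      generalize thetaFact τ (2 * η) (2 * η) n = t13 at *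
      generalize theta τ (2 * η + n * (2 * η)) = t14 at *
      generalize theta τ (A - B + 2 * (k + 1 - (l + 1)) * η) = t15 at *
      generalize theta τ (z + B + 2 * (k + 1 + (l + 1) - 1 + (l + 1)) * η) = y1 at *
      generalize theta τ (z + A + 2 * (k + 1 + (l + 1) - 1 + (k + 1)) * η) = y2 at *
      generalize theta τ (z + B + 2 * (l + 1 - 1) * η) = y3 at *
      generalize theta τ (z + A + 2 * (k + 1 - 1) * η) = y4 at *
      generalize theta τ (z + B + 2 * (k + 1 + (l + 1) - 1) * η) = y5 at *
      generalize theta τ (z + A + 2 * (k + 1 + (l + 1) - 1) * η) = y6 at *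
      generalize theta τ (z - A + l * (2 * η)) = y7 at *
      generalize theta τ (z - B + k * (2 * η)) = y8 at *
      generalize thetaFact τ (2 * η) (z + B + 2 * (l + 1 : ℕ) * η) k = y9 at *
      generalize thetaFact τ (2 * η) (z + A + 2 * (k + 1 : ℕ) * η) l = y10 at *
      generalize thetaFact τ (2 * η) (z - A) l = y11 at *
      generalize thetaFact τ (2 * η) (z - B) k = y12 at *
      clear * - three h1 h2 h3 h4 h5 h6 h7 h8 h9 h10 h11 h12
      have hc : t14 * t15 * (y5 * y6) = t5 * t9 * (y1 * y4) + t6 * t11 * (y2 * y3) := three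
      rw [pow_succ]
      field_simp
      linear_combination (y8 * t13 * y12 * y9 * y11 * y7 * y10) * hc

lemma Generic.nondegenerate {τ η a b : ℂ} (hg : Generic τ η (a + b) (a - b)) (N : ℕ) :
    Nondegenerate τ η N a b := by
  intro k l _
  rw [thetaPair_add_mul]
  have h1 := hg.sum (k + l)
  have h2 := hg.diff (k - l)
  push_cast at h1 h2
  exact mul_ne_zero h1 h2

lemma Generic.dual {τ η a b : ℂ} (hτ : 0 < τ.im) (hg : Generic τ η (a + b) (a - b)) (N : ℕ) :
    Generic τ η (η * (1 - N) - b + (η * (1 - N) - a))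
      (η * (1 - N) - b - (η * (1 - N) - a)) where
  step := hg.step
  sum j := by
    have := hg.sum (N - 1 - j)
    rw [← neg_ne_zero, ← theta_neg hτ]
    convert this using 2
    push_cast
    ring
  diff j := by
    convert hg.diff j using 2
    ring

lemma thetaBasis_eq_thetaFact (τ η a b : ℂ) (k l : ℕ) (y : ℂ) :
    thetaBasis τ η a b k l y
      = thetaFact τ (2 * η) (a + y) k * thetaFact τ (2 * η) (a - y) k
        * (thetaFact τ (2 * η) (b + y) l * thetaFact τ (2 * η) (b - y) l) := by
  simp only [thetaBasis, thetaPair, thetaFact, ← Finset.prod_mul_distrib]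
  congr 1 <;> refine Finset.prod_congr rfl fun j _ => ?_ <;> congr 2 <;> ring

/-- Reproducing property of the dual bases `e_k^N(y; a, b)` and
`e_k^N(x; η(1-N)-b, η(1-N)-a)`. -/
theorem kernel_eq_sum {τ η a b : ℂ} (hτ : 0 < τ.im) (hg : Generic τ η (a + b) (a - b)) (N : ℕ)
    (x y : ℂ) :
    (-1) ^ N * ∏ i ∈ Finset.range N, thetaPair τ (y - (N - 1) * η + 2 * i * η) x
      = ∑ q ∈ antidiagonal N, kernelCoeff τ η (2 * η * (1 - N) - (a + b)) (a - b) q.1 q.2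
        * thetaBasis τ η a b q.1 q.2 y
        * thetaBasis τ η (η * (1 - N) - b) (η * (1 - N) - a) q.1 q.2 x := by
  have hg' := hg.dual hτ N
  rw [prod_thetaPair_eq_sum hτ (hg'.nondegenerate N) (fun i => y - (N - 1) * η + 2 * i * η) N le_rfl,
    Finset.mul_sum]
  refine Finset.sum_congr rfl fun q hq => ?_
  obtain ⟨k, l⟩ := q
  rw [mem_antidiagonal] at hq
  simp only at hq ⊢
  rw [expansionCoeff_eq hτ hg' _ _ _ _ hq, thetaBasis_eq_thetaFact τ η a b]
  have hN : (N : ℂ) = k + l := by rw [← hq]; push_cast; ring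
  have e1 : thetaFact τ (2 * η) (y - (N - 1) * η + (η * (1 - N) - a) + 2 * l * η) k
      = (-1) ^ k * thetaFact τ (2 * η) (a - y) k := by
    rw [thetaFact_reflect, ← thetaFact_neg hτ, hN]
    congr 1
    ring
  have e2 : thetaFact τ (2 * η) (y - (N - 1) * η + (η * (1 - N) - b) + 2 * k * η) l
      = (-1) ^ l * thetaFact τ (2 * η) (b - y) l := by
    rw [thetaFact_reflect, ← thetaFact_neg hτ, hN]
    congr 1
    ring
  rw [e1, e2, show η * (1 - N) - b + (η * (1 - N) - a) = 2 * η * (1 - N) - (a + b) by ring,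
    show η * (1 - N) - b - (η * (1 - N) - a) = a - b by ring,
    show y - (N - 1) * η - (η * (1 - N) - a) = a + y by ring,
    show y - (N - 1) * η - (η * (1 - N) - b) = b + y by ring]
  have hsq : (-1 : ℂ) ^ N * ((-1) ^ k * (-1) ^ l) = 1 := by
    rw [← pow_add, hq, ← mul_pow]; simp
  linear_combination kernelCoeff τ η (2 * η * (1 - N) - (a + b)) (a - b) k l
    * thetaFact τ (2 * η) (a + y) k * thetaFact τ (2 * η) (a - y) k
    * thetaFact τ (2 * η) (b + y) l * thetaFact τ (2 * η) (b - y) l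
    * thetaBasis τ η (η * (1 - N) - b) (η * (1 - N) - a) k l x * hsq

lemma sf_eq_thetaFact (τ η x : ℂ) (k : ℕ) : sf τ η x k = thetaFact τ (2 * η) (2 * η * x) k := by
  simp only [sf, br, thetaFact]
  refine Finset.prod_congr rfl fun j _ => ?_
  congr 1
  ring

lemma Generic.eta_ne_zero {τ η s m : ℂ} (hτ : 0 < τ.im) (hg : Generic τ η s m) : η ≠ 0 := by
  rintro rfl
  exact hg.step 1 one_ne_zero (by rw [mul_zero, theta_zero hτ])

lemma Generic.thetaFact_step_ne_zero {τ η s m : ℂ} (hg : Generic τ η s m) (n : ℕ) :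
    thetaFact τ (2 * η) (2 * η) n ≠ 0 := thetaFact_ne_zero fun j _ => by
  convert hg.step (j + 1) (by omega) using 2; push_cast; ring

lemma Generic.thetaFact_diff_ne_zero {τ η s m : ℂ} (hg : Generic τ η s m) (i : ℤ) (n : ℕ) :
    thetaFact τ (2 * η) (m + 2 * i * η) n ≠ 0 := thetaFact_ne_zero fun j _ => by
  convert hg.diff (i + j) using 2; push_cast; ring

lemma Generic.thetaFact_diff_ne_zero' {τ η s m : ℂ} (hg : Generic τ η s m) (n : ℕ) :
    thetaFact τ (-(2 * η)) m n ≠ 0 := thetaFact_ne_zero fun j _ => by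
  convert hg.diff (-j) using 2; push_cast; ring

lemma Generic.thetaFact_sum_ne_zero {τ η s m : ℂ} (hg : Generic τ η s m) (n : ℕ) :
    thetaFact τ (2 * η) s n ≠ 0 := thetaFact_ne_zero fun j _ => by
  convert hg.sum j using 2; push_cast; ring

/-- The part of the factor `dualFactor` that depends on the parameters `(c, d)`. -/
def sideFactor (τ η : ℂ) (N : ℕ) (c d : ℂ) (l : ℕ) : ℂ :=
  br τ η (spec η N c d + 2 * l) / br τ η (spec η N c d)
    * ((sf τ η (-(N : ℂ)) l * sf τ η (spec η N c d) l)
      / (sf τ η 1 l * sf τ η (spec η N c d + N + 1) l))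
    / (sf τ η (spec η N c d + 1) N * sf τ η ((c + d) / (2 * η)) N)

lemma dualFactor_eq_div (τ : ℂ) (N k l : ℕ) (η a b c d : ℂ) :
    dualFactor τ N k l η a b c d = sideFactor τ η N c d l / sideFactor τ η N a b k := by
  simp only [dualFactor, sideFactor, div_eq_mul_inv, mul_inv, inv_inv]
  ring

lemma two_mul_eta_mul_spec {η : ℂ} (hη : η ≠ 0) (N : ℕ) (c d : ℂ) :
    2 * η * spec η N c d = c - d - 2 * N * η := by
  rw [spec]; field_simp

lemma sideFactor_eq_kernelCoeff {τ η c d : ℂ} (hτ : 0 < τ.im)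
    (hg : Generic τ η (c + d) (c - d)) (N l l' : ℕ) (hN : l + l' = N) :
    sideFactor τ η N c d l = kernelCoeff τ η (2 * η * (1 - N) - (c + d)) (c - d) l l' := by
  have hη := hg.eta_ne_zero hτ
  have hNc : (N : ℂ) = l + l' := by rw [← hN]; push_cast; ring
  have hlam := two_mul_eta_mul_spec hη N c d
  have e1 : sf τ η (spec η N c d + 1) N = thetaFact τ (-(2 * η)) (c - d) N := by
    rw [sf_eq_thetaFact, thetaFact_reflect]; congr 1; linear_combination hlam
  have e2 : thetaFact τ (2 * η) (2 * η * (1 - N) - (c + d)) N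
      = (-1) ^ N * sf τ η ((c + d) / (2 * η)) N := by
    rw [sf_eq_thetaFact, thetaFact_reflect, ← thetaFact_neg hτ]; congr 1; field_simp; ring
  have e3 : thetaFact τ (-(2 * η)) (c - d) (N + 1)
      = thetaFact τ (-(2 * η)) (c - d) (l' + 1) * sf τ η (spec η N c d) l := by
    rw [show N + 1 = l' + 1 + l by omega, thetaFact_add, sf_eq_thetaFact,
      thetaFact_reflect τ (2 * η), hlam, hNc]
    congr 2; push_cast; ring
  have e3' : thetaFact τ (-(2 * η)) (c - d) (N + 1)
      = thetaFact τ (-(2 * η)) (c - d) N * br τ η (spec η N c d) := by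
    rw [thetaFact_succ, br, hlam]; congr 2; ring
  have e4 : thetaFact τ (2 * η) (2 * η) N * (-1) ^ l
      = thetaFact τ (2 * η) (2 * η) l' * sf τ η (-(N : ℂ)) l := by
    have : sf τ η (-(N : ℂ)) l = (-1) ^ l * thetaFact τ (2 * η) (2 * η + l' * (2 * η)) l := by
      rw [sf_eq_thetaFact, thetaFact_reflect, ← thetaFact_neg hτ, hNc]
      congr 1; ring
    rw [this, ← hN, add_comm l l', thetaFact_add]; ring
  have e5 : sf τ η 1 l = thetaFact τ (2 * η) (2 * η) l := by rw [sf_eq_thetaFact, mul_one]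
  have e6 : sf τ η (spec η N c d + N + 1) l = thetaFact τ (2 * η) (c - d + 2 * η) l := by
    rw [sf_eq_thetaFact]; congr 1; linear_combination hlam
  have e7 : br τ η (spec η N c d + 2 * l) = theta τ (c - d + 2 * (l - l') * η) := by
    rw [br]; congr 1; rw [hNc] at hlam; linear_combination hlam
  have h1 := hg.thetaFact_step_ne_zero l
  have h2 := hg.thetaFact_step_ne_zero l'
  have h3 := hg.thetaFact_diff_ne_zero' (l' + 1)
  have h4 := hg.thetaFact_diff_ne_zero' N
  have h5 : thetaFact τ (2 * η) (c - d + 2 * η) l ≠ 0 := by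
    simpa using hg.thetaFact_diff_ne_zero 1 l
  have h6 : br τ η (spec η N c d) ≠ 0 := by
    intro h
    rw [h, mul_zero] at e3'
    exact hg.thetaFact_diff_ne_zero' _ e3'
  have h7 : sf τ η ((c + d) / (2 * η)) N ≠ 0 := by
    rw [sf_eq_thetaFact, mul_div_cancel₀ _ (mul_ne_zero two_ne_zero hη)]
    exact hg.thetaFact_sum_ne_zero N
  have hsN : (-1 : ℂ) ^ N = (-1) ^ l * (-1) ^ l' := by rw [← pow_add, hN]
  have hs1 : (-1 : ℂ) ^ l ≠ 0 := pow_ne_zero _ (by norm_num)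
  have hs2 : (-1 : ℂ) ^ l' ≠ 0 := pow_ne_zero _ (by norm_num)
  have hsq : ((-1 : ℂ) ^ l) ^ 2 = 1 := by rw [← pow_mul, mul_comm, pow_mul]; simp
  rw [sideFactor, kernelCoeff, hN, e1, e2, e5, e6, e7, hsN]
  rw [e3'] at e3
  have e8 : sf τ η (spec η N c d) l = thetaFact τ (-(2 * η)) (c - d) N * br τ η (spec η N c d)
      / thetaFact τ (-(2 * η)) (c - d) (l' + 1) := by rw [e3]; field_simp
  have e9 : sf τ η (-(N : ℂ)) l = thetaFact τ (2 * η) (2 * η) N * (-1) ^ l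
      / thetaFact τ (2 * η) (2 * η) l' := by rw [e4]; field_simp
  rw [e8, e9]
  generalize (-1 : ℂ) ^ l = t1 at *
  generalize (-1 : ℂ) ^ l' = t2 at *
  generalize thetaFact τ (2 * η) (2 * η) N = t3 at *
  generalize thetaFact τ (2 * η) (2 * η) l = t4 at *
  generalize thetaFact τ (2 * η) (2 * η) l' = t5 at *
  generalize thetaFact τ (-(2 * η)) (c - d) (l' + 1) = t6 at *
  generalize thetaFact τ (-(2 * η)) (c - d) N = t7 at *
  generalize thetaFact τ (2 * η) (c - d + 2 * η) l = t8 at *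
  generalize br τ η (spec η N c d) = t9 at *
  generalize sf τ η ((c + d) / (2 * η)) N = t10 at *
  generalize theta τ (c - d + 2 * (l - l') * η) = t11 at *
  clear * - h1 h2 h3 h4 h5 h6 h7 hs1 hs2 hsq
  field_simp
  linear_combination t3 * t11 * hsq

lemma kernelCoeff_ne_zero {τ η s m s' : ℂ} (hg : Generic τ η s m) (hg' : Generic τ η s' m)
    (k l : ℕ) : kernelCoeff τ η s' m k l ≠ 0 := by
  have h1 := hg'.diff (k - l)
  have h2 := hg'.thetaFact_diff_ne_zero 1 k
  push_cast at h1 h2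
  rw [mul_one] at h2
  exact mul_ne_zero (div_ne_zero (mul_ne_zero (pow_ne_zero _ (by norm_num))
    (div_ne_zero (hg.thetaFact_step_ne_zero _) (mul_ne_zero (hg.thetaFact_step_ne_zero _)
      (hg.thetaFact_step_ne_zero _)))) (hg'.thetaFact_sum_ne_zero _))
    (div_ne_zero h1 (mul_ne_zero (hg.thetaFact_diff_ne_zero' _) h2))

/-- Self-duality of the connection coefficients for generic parameters. -/
theorem R_eq_dualFactor_mul_of_generic {τ η a b c d : ℂ} (hτ : 0 < τ.im)
    (hab : Generic τ η (a + b) (a - b)) (hcd : Generic τ η (c + d) (c - d)) (N : ℕ)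
    (k l : Fin (N + 1)) :
    R τ η N a b c d k l = dualFactor τ N k l η a b c d
      * R τ η N (η * (1 - N) - d) (η * (1 - N) - c) (η * (1 - N) - b) (η * (1 - N) - a) l k := by
  set f : ℂ → ℂ → ℕ → ℂ := fun a b k =>
    kernelCoeff τ η (2 * η * (1 - N) - (a + b)) (a - b) k (N - k) with hf
  have hf0 : ∀ {a b : ℂ}, Generic τ η (a + b) (a - b) → ∀ k, f a b k ≠ 0 := fun {a b} hg k => by
    refine kernelCoeff_ne_zero hg ?_ _ _
    convert hg.dual hτ N using 1 <;> ring
  have hker : ∀ {a b : ℂ}, Generic τ η (a + b) (a - b) → ∀ x y, ∑ k : Fin (N + 1),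
      f a b k * e τ η N a b k y * e τ η N (η * (1 - N) - b) (η * (1 - N) - a) k x
      = (-1) ^ N * ∏ i ∈ Finset.range N, thetaPair τ (y - (N - 1) * η + 2 * i * η) x := by
    intro a b hg x y
    rw [kernel_eq_sum hτ hg N x y, ← sum_fin_eq_sum_antidiagonal N fun i j =>
      kernelCoeff τ η (2 * η * (1 - N) - (a + b)) (a - b) i j * thetaBasis τ η a b i j y
        * thetaBasis τ η (η * (1 - N) - b) (η * (1 - N) - a) i j x]
    simp only [e_eq_thetaBasis, hf]
  have hR := isExpansion_R hτ (hcd.nondegenerate N) a b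
  have h1 : ∀ x, (fun l : Fin (N + 1) => (∑ k : Fin (N + 1), f a b k * R τ η N a b c d k l
      * e τ η N (η * (1 - N) - b) (η * (1 - N) - a) k x)
      - f c d l * e τ η N (η * (1 - N) - d) (η * (1 - N) - c) l x) = 0 := by
    intro x
    refine eq_zero_of_sum_e_eq_zero hτ (hcd.nondegenerate N) fun y => ?_
    have h := (hker hab x y).trans (hker hcd x y).symm
    simp only [hR _ y] at h
    simp only [sub_mul, Finset.sum_sub_distrib]
    rw [sub_eq_zero]
    have h2 : ∑ l : Fin (N + 1), f c d l * e τ η N (η * (1 - N) - d) (η * (1 - N) - c) l x * e τ η N c d l y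
        = ∑ l : Fin (N + 1), f c d l * e τ η N c d l y * e τ η N (η * (1 - N) - d) (η * (1 - N) - c) l x :=
      Finset.sum_congr rfl fun _ _ => by ring
    rw [h2, ← h]
    simp only [Finset.sum_mul, Finset.mul_sum]
    rw [Finset.sum_comm]
    exact Finset.sum_congr rfl fun _ _ => Finset.sum_congr rfl fun _ _ => by ring
  have h2 : IsExpansion τ η N (η * (1 - N) - d) (η * (1 - N) - c) (η * (1 - N) - b)
      (η * (1 - N) - a) l fun k => f a b k * R τ η N a b c d k l / f c d l := by
    intro x
    have h := congrFun (h1 x) l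
    simp only [Pi.zero_apply, sub_eq_zero] at h
    rw [← mul_right_inj' (hf0 hcd l), ← h, Finset.mul_sum]
    refine Finset.sum_congr rfl fun k _ => ?_
    have := hf0 hcd l
    field_simp
  have hab' := (hab.dual hτ N).nondegenerate N
  have h3 := congrFun ((isExpansion_R hτ hab' _ _ l).unique hτ hab' h2) k
  rw [h3, dualFactor_eq_div, sideFactor_eq_kernelCoeff hτ hcd N l (N - l) (by omega),
    sideFactor_eq_kernelCoeff hτ hab N k (N - k) (by omega)]
  have h4 := hf0 hab k
  have h5 := hf0 hcd l
  simp only [hf] at h4 h5 ⊢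
  field_simp

/-- The parameters for which both bases are generic. -/
def genericSet (τ : ℂ) : Set (ℂ × ℂ × ℂ × ℂ × ℂ) :=
  {P | Generic τ P.1 (P.2.1 + P.2.2.1) (P.2.1 - P.2.2.1) ∧
    Generic τ P.1 (P.2.2.2.1 + P.2.2.2.2) (P.2.2.2.1 - P.2.2.2.2)}

lemma theta_comp_ne_zero_mem_residual {X : Type*} [TopologicalSpace X] [AddCommGroup X]
    [Module ℂ X] [ContinuousAdd X] [ContinuousSMul ℂ X] {τ : ℂ} (hτ : 0 < τ.im) {f : X → ℂ}
    (hf : Continuous f) (v : X) {κ : ℂ} (hκ : κ ≠ 0) (hv : ∀ P (t : ℂ), f (P + t • v) = f P + t * κ) :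
    {P | theta τ (f P) ≠ 0} ∈ residual X := by
  refine residual_of_dense_open (isOpen_ne_fun ((continuous_theta hτ).comp hf) continuous_const)
    fun P => ?_
  have h0 : Dense (((Homeomorph.mulRight₀ κ hκ).trans (Homeomorph.addLeft (f P))) ⁻¹'
      {x | theta τ x ≠ 0}) := (dense_theta_ne_zero hτ).preimage (Homeomorph.isOpenMap _)
  have h1 : Continuous fun t : ℂ => P + t • v := by fun_prop
  have h2 := map_mem_closure h1 (h0 0) (t := {P | theta τ (f P) ≠ 0}) fun t ht => by
    simp only [Set.mem_ofPred_eq, hv]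
    exact ht
  simpa using h2

lemma dense_genericSet {τ : ℂ} (hτ : 0 < τ.im) : Dense (genericSet τ) := by
  apply dense_of_mem_residual
  have key : ∀ (f : ℂ × ℂ × ℂ × ℂ × ℂ → ℂ) (v : ℂ × ℂ × ℂ × ℂ × ℂ) (κ : ℂ), κ ≠ 0 →
      Continuous f → (∀ P (t : ℂ), f (P + t • v) = f P + t * κ) →
      ∀ᶠ P in residual (ℂ × ℂ × ℂ × ℂ × ℂ), theta τ (f P) ≠ 0 := fun f v κ hκ hf hv =>
    theta_comp_ne_zero_mem_residual hτ hf v hκ hv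
  have h1 : ∀ᶠ P in residual (ℂ × ℂ × ℂ × ℂ × ℂ), ∀ j : ℤ, j ≠ 0 → theta τ (2 * j * P.1) ≠ 0 := by
    refine eventually_countable_forall.2 fun j => ?_
    by_cases hj : j = 0
    · exact Eventually.of_forall fun _ h => absurd hj h
    · filter_upwards [key (fun P => 2 * j * P.1) (1, 0, 0, 0, 0) (2 * j)
        (mul_ne_zero two_ne_zero (Int.cast_ne_zero.2 hj)) (by fun_prop)
        (fun P t => by simp; ring)] with P hP _ using hP
  have h2 := eventually_countable_forall.2 fun j : ℤ =>
    key (fun P => P.2.1 + P.2.2.1 + 2 * j * P.1) (0, 1, 0, 0, 0) 1 one_ne_zero (by fun_prop)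
      (fun P t => by simp; ring)
  have h3 := eventually_countable_forall.2 fun j : ℤ =>
    key (fun P => P.2.1 - P.2.2.1 + 2 * j * P.1) (0, 1, 0, 0, 0) 1 one_ne_zero (by fun_prop)
      (fun P t => by simp; ring)
  have h4 := eventually_countable_forall.2 fun j : ℤ =>
    key (fun P => P.2.2.2.1 + P.2.2.2.2 + 2 * j * P.1) (0, 0, 0, 1, 0) 1 one_ne_zero
      (by fun_prop) (fun P t => by simp; ring)
  have h5 := eventually_countable_forall.2 fun j : ℤ =>
    key (fun P => P.2.2.2.1 - P.2.2.2.2 + 2 * j * P.1) (0, 0, 0, 1, 0) 1 one_ne_zero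
      (by fun_prop) (fun P t => by simp; ring)
  filter_upwards [h1, h2, h3, h4, h5] with P e1 e2 e3 e4 e5
  exact ⟨⟨e1, e2, e3⟩, ⟨e1, e4, e5⟩⟩

lemma Generic.br_spec_ne_zero {τ η c d : ℂ} (hτ : 0 < τ.im)
    (hg : Generic τ η (c + d) (c - d)) (N : ℕ) (i : ℤ) : br τ η (spec η N c d + i) ≠ 0 := by
  have := hg.diff (i - N)
  rw [br]
  convert this using 2
  push_cast
  linear_combination two_mul_eta_mul_spec (hg.eta_ne_zero hτ) N c d

lemma Generic.sf_spec_ne_zero {τ η c d : ℂ} (hτ : 0 < τ.im)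
    (hg : Generic τ η (c + d) (c - d)) (N : ℕ) (i : ℤ) (n : ℕ) :
    sf τ η (spec η N c d + i) n ≠ 0 :=
  Finset.prod_ne_zero_iff.2 fun j _ => by
    simpa [add_assoc] using hg.br_spec_ne_zero hτ N (i + j)

lemma Generic.sf_int_ne_zero {τ η s m : ℂ} (hg : Generic τ η s m) (i : ℤ) (n : ℕ)
    (h : ∀ j : ℕ, j < n → i + j ≠ 0) : sf τ η i n ≠ 0 :=
  Finset.prod_ne_zero_iff.2 fun j hj => by
    rw [br]
    convert hg.step (i + j) (h j (Finset.mem_range.1 hj)) using 2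
    push_cast; ring

lemma genericSet_subset_regularSet {τ : ℂ} (hτ : 0 < τ.im) {N k l : ℕ} (hk : k ≤ N) :
    genericSet τ ⊆ regularSet τ N k l := by
  rintro ⟨η, a, b, c, d⟩ ⟨hab, hcd⟩
  have hη := hab.eta_ne_zero hτ
  simp only at hab hcd hη
  refine ⟨hη, ?_⟩
  have h1 := hcd.sf_spec_ne_zero hτ N 1 N
  have h2 : sf τ η ((c + d) / (2 * η)) N ≠ 0 := by
    rw [sf_eq_thetaFact, mul_div_cancel₀ _ (mul_ne_zero two_ne_zero hη)]
    exact hcd.thetaFact_sum_ne_zero N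
  have h3 := hcd.br_spec_ne_zero hτ N 0
  have h4 := hcd.sf_int_ne_zero 1 l (fun j _ => by omega)
  have h5 := hcd.sf_spec_ne_zero hτ N (N + 1) l
  have h6 := hab.br_spec_ne_zero hτ N (2 * k)
  have h7 := hab.sf_int_ne_zero (-N) k (fun j _ => by omega)
  have h8 := hab.sf_spec_ne_zero hτ N 0 k
  push_cast at h1 h3 h4 h5 h6 h7 h8
  rw [add_zero] at h3 h8
  rw [← add_assoc] at h5
  simp only [dualDenominator]
  exact mul_ne_zero (mul_ne_zero (mul_ne_zero (mul_ne_zero (mul_ne_zero h1 h2) h3)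
    (mul_ne_zero h4 h5)) h6) (mul_ne_zero h7 h8)

/-- The self-duality relation with the factor replaced by its limit. -/
theorem R_eq_mul_of_tendsto {τ η a b c d Φ : ℂ} (hτ : 0 < τ.im) {N : ℕ}
    (hab : Nondegenerate τ η N (η * (1 - N) - b) (η * (1 - N) - a))
    (hcd : Nondegenerate τ η N c d) (k l : Fin (N + 1))
    (h : Tendsto (fun P : ℂ × ℂ × ℂ × ℂ × ℂ =>
        dualFactor τ N k l P.1 P.2.1 P.2.2.1 P.2.2.2.1 P.2.2.2.2)
      (𝓝[regularSet τ N k l] (η, a, b, c, d)) (𝓝 Φ)) :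
    R τ η N a b c d k l = Φ * R τ η N (η * (1 - N) - d) (η * (1 - N) - c)
      (η * (1 - N) - b) (η * (1 - N) - a) l k := by
  have hne : (𝓝[genericSet τ] (η, a, b, c, d)).NeBot :=
    mem_closure_iff_nhdsWithin_neBot.1 (dense_genericSet hτ _)
  have h1 := (continuousAt_R (X := ℂ × ℂ × ℂ × ℂ × ℂ) (p := (η, a, b, c, d)) hτ
    (η := fun P => P.1) (a := fun P => P.2.1) (b := fun P => P.2.2.1) (c := fun P => P.2.2.2.1)
    (d := fun P => P.2.2.2.2) (by fun_prop) (by fun_prop) (by fun_prop)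
    (by fun_prop) (by fun_prop) hcd k l).tendsto
  have h2 := (continuousAt_R (X := ℂ × ℂ × ℂ × ℂ × ℂ) (p := (η, a, b, c, d)) hτ
    (η := fun P => P.1) (a := fun P => P.1 * (1 - N) - P.2.2.2.2)
    (b := fun P => P.1 * (1 - N) - P.2.2.2.1) (c := fun P => P.1 * (1 - N) - P.2.2.1)
    (d := fun P => P.1 * (1 - N) - P.2.1) (by fun_prop) (by fun_prop) (by fun_prop)
    (by fun_prop) (by fun_prop) hab l k).tendsto
  have h3 := (h.mono_left (nhdsWithin_mono _
    (genericSet_subset_regularSet hτ (Nat.lt_succ_iff.1 k.2)))).mul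
    (h2.mono_left nhdsWithin_le_nhds)
  refine tendsto_nhds_unique (h1.mono_left nhdsWithin_le_nhds) (h3.congr' ?_)
  filter_upwards [self_mem_nhdsWithin] with P hP
  exact (R_eq_dualFactor_mul_of_generic hτ hP.1 hP.2 N k l).symm

lemma continuousAt_br {X : Type*} [TopologicalSpace X] {τ : ℂ} (hτ : 0 < τ.im) {η x : X → ℂ}
    {p : X} (hη : ContinuousAt η p) (hx : ContinuousAt x p) :
    ContinuousAt (fun y => br τ (η y) (x y)) p :=
  continuousAt_theta_comp hτ (by fun_prop)

lemma continuousAt_sf {X : Type*} [TopologicalSpace X] {τ : ℂ} (hτ : 0 < τ.im) {η x : X → ℂ}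
    {p : X} (hη : ContinuousAt η p) (hx : ContinuousAt x p) (n : ℕ) :
    ContinuousAt (fun y => sf τ (η y) (x y) n) p :=
  tendsto_finsetProd _ fun _ _ => continuousAt_br hτ hη (hx.add continuousAt_const)

lemma continuousAt_spec {X : Type*} [TopologicalSpace X] {η c d : X → ℂ} {p : X}
    (hη : ContinuousAt η p) (hc : ContinuousAt c p) (hd : ContinuousAt d p) (h0 : η p ≠ 0)
    (N : ℕ) : ContinuousAt (fun y => spec (η y) N (c y) (d y)) p :=
  ContinuousAt.div (by fun_prop) (by fun_prop) (mul_ne_zero two_ne_zero h0)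

/-- The factor of the self-duality relation is continuous where its formula makes sense. -/
lemma continuousAt_dualFactor {τ : ℂ} (hτ : 0 < τ.im) {N k l : ℕ} {P : ℂ × ℂ × ℂ × ℂ × ℂ}
    (hP : P ∈ regularSet τ N k l) :
    ContinuousAt (fun P : ℂ × ℂ × ℂ × ℂ × ℂ =>
      dualFactor τ N k l P.1 P.2.1 P.2.2.1 P.2.2.2.1 P.2.2.2.2) P := by
  obtain ⟨h0, h⟩ := hP
  simp only [dualDenominator, mul_ne_zero_iff] at h
  obtain ⟨⟨⟨⟨⟨h1, h2⟩, h3⟩, h4, h5⟩, h6⟩, h7, h8⟩ := h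
  have hη : ContinuousAt (fun P : ℂ × ℂ × ℂ × ℂ × ℂ => P.1) P := by fun_prop
  have hab : ContinuousAt (fun P : ℂ × ℂ × ℂ × ℂ × ℂ => spec P.1 N P.2.1 P.2.2.1) P :=
    continuousAt_spec hη (by fun_prop) (by fun_prop) h0 N
  have hcd : ContinuousAt (fun P : ℂ × ℂ × ℂ × ℂ × ℂ => spec P.1 N P.2.2.2.1 P.2.2.2.2) P :=
    continuousAt_spec hη (by fun_prop) (by fun_prop) h0 N
  have hs : ContinuousAt (fun P : ℂ × ℂ × ℂ × ℂ × ℂ => (P.2.1 + P.2.2.1) / (2 * P.1)) P :=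
    ContinuousAt.div (by fun_prop) (by fun_prop) (mul_ne_zero two_ne_zero h0)
  have hs' : ContinuousAt (fun P : ℂ × ℂ × ℂ × ℂ × ℂ => (P.2.2.2.1 + P.2.2.2.2) / (2 * P.1)) P :=
    ContinuousAt.div (by fun_prop) (by fun_prop) (mul_ne_zero two_ne_zero h0)
  have S : ∀ {η x : ℂ × ℂ × ℂ × ℂ × ℂ → ℂ}, ContinuousAt η P → ContinuousAt x P → ∀ n,
    ContinuousAt (fun y => sf τ (η y) (x y) n) P := continuousAt_sf hτ
  have B : ∀ {η x : ℂ × ℂ × ℂ × ℂ × ℂ → ℂ}, ContinuousAt η P → ContinuousAt x P →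
    ContinuousAt (fun y => br τ (η y) (x y)) P := continuousAt_br hτ
  simp only [dualFactor]
  refine ContinuousAt.mul (ContinuousAt.mul (ContinuousAt.mul (ContinuousAt.mul ?_ ?_) ?_) ?_) ?_
  · exact ContinuousAt.div ((S hη (hab.add continuousAt_const) _).mul (S hη hs _))
      ((S hη (hcd.add continuousAt_const) _).mul (S hη hs' _)) (mul_ne_zero h1 h2)
  · exact ContinuousAt.div (B hη (hcd.add continuousAt_const)) (B hη hcd) h3
  · exact ContinuousAt.div ((S hη continuousAt_const _).mul (S hη hcd _))
      ((S hη continuousAt_const _).mul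
        (S hη ((hcd.add continuousAt_const).add continuousAt_const) _)) (mul_ne_zero h4 h5)
  · exact ContinuousAt.div (B hη hab) (B hη (hab.add continuousAt_const)) h6
  · exact ContinuousAt.div ((S hη continuousAt_const _).mul
      (S hη ((hab.add continuousAt_const).add continuousAt_const) _))
      ((S hη continuousAt_const _).mul (S hη hab _)) (mul_ne_zero h7 h8)

lemma continuousAt_thetaFact {X : Type*} [TopologicalSpace X] {τ : ℂ} (hτ : 0 < τ.im)
    {h y : X → ℂ} {p : X} (hh : ContinuousAt h p) (hy : ContinuousAt y p) (n : ℕ) :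
    ContinuousAt (fun x => thetaFact τ (h x) (y x) n) p :=
  tendsto_finsetProd _ fun _ _ =>
    continuousAt_theta_comp hτ (hy.add (continuousAt_const.mul hh))

/-- The elliptic binomial coefficient has a nonzero limit at `η = 0`. -/
lemma exists_tendsto_sf_div_sf {X : Type*} [TopologicalSpace X] {τ : ℂ} (hτ : 0 < τ.im)
    {η : X → ℂ} {p : X} {s : Set X} (hη : ContinuousAt η p) {N l : ℕ} (hl : l ≤ N)
    (h0 : η p = 0 ∨ ∀ j : ℤ, j ≠ 0 → |j| ≤ N → 2 * j * η p ∉ lattice τ)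
    (hs : ∀ᶠ y in 𝓝[s] p, η y ≠ 0) :
    ∃ L : ℂ, L ≠ 0 ∧
      Tendsto (fun y => sf τ (η y) (-(N : ℂ)) l / sf τ (η y) 1 l) (𝓝[s] p) (𝓝 L) := by
  obtain ⟨t, htc, ht0, ht⟩ := exists_theta_eq_mul hτ
  have htne : ∀ j : ℤ, j ≠ 0 → |j| ≤ N → t (2 * η p * j) ≠ 0 := fun j hj hjN h => by
    rcases h0 with h0 | h0
    · rw [h0] at h
      simp only [mul_zero, zero_mul] at h
      exact ht0 h
    · refine theta_ne_zero hτ (h0 j hj hjN) ?_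
      rw [show 2 * j * η p = 2 * η p * j by ring, ht, h, mul_zero]
  have hcont : ∀ i : ℂ, ContinuousAt (fun y => t (2 * η y * i)) p := fun i =>
    ContinuousAt.comp (g := t) htc.continuousAt (by fun_prop)
  have hne1 : ∀ j : ℕ, j < l → (-(N : ℂ) + j) ≠ 0 := fun j hj h => by
    have : (-(N : ℤ) + j) = 0 := by exact_mod_cast h
    omega
  have hne2 : ∀ j : ℕ, (1 + j : ℂ) ≠ 0 := fun j h => by
    have : (1 + j : ℤ) = 0 := by exact_mod_cast h
    omega
  have ht1 : ∀ j : ℕ, j < l → t (2 * η p * (-(N : ℂ) + j)) ≠ 0 := fun j hj => by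
    have := htne (-(N : ℤ) + j) (by omega) (by rw [abs_le]; omega)
    push_cast at this
    exact this
  have ht2 : ∀ j : ℕ, j < l → t (2 * η p * (1 + j)) ≠ 0 := fun j hj => by
    have := htne (1 + j) (by omega) (by rw [abs_le]; omega)
    push_cast at this
    exact this
  refine ⟨∏ j ∈ Finset.range l, ((-(N : ℂ) + j) * t (2 * η p * (-(N : ℂ) + j))
      / ((1 + j) * t (2 * η p * (1 + j)))), Finset.prod_ne_zero_iff.2 fun j hj => ?_, ?_⟩
  · have hj := Finset.mem_range.1 hj
    exact div_ne_zero (mul_ne_zero (hne1 j hj) (ht1 j hj)) (mul_ne_zero (hne2 j) (ht2 j hj))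
  · have hmain : Tendsto (fun y => ∏ j ∈ Finset.range l, ((-(N : ℂ) + j)
        * t (2 * η y * (-(N : ℂ) + j)) / ((1 + j) * t (2 * η y * (1 + j))))) (𝓝[s] p)
        (𝓝 (∏ j ∈ Finset.range l, ((-(N : ℂ) + j) * t (2 * η p * (-(N : ℂ) + j))
          / ((1 + j) * t (2 * η p * (1 + j)))))) := by
      refine tendsto_finsetProd _ fun j hj => ?_
      have hj := Finset.mem_range.1 hj
      exact ((ContinuousAt.div (continuousAt_const.mul (hcont _))
        (continuousAt_const.mul (hcont _)) (mul_ne_zero (hne2 j) (ht2 j hj))).tendsto).mono_left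
        nhdsWithin_le_nhds
    refine hmain.congr' ?_
    filter_upwards [hs] with y hy
    rw [sf, sf, ← Finset.prod_div_distrib]
    refine Finset.prod_congr rfl fun j _ => ?_
    rw [br, br, ht, ht, mul_assoc (2 * η y), mul_assoc (2 * η y),
      mul_div_mul_left _ _ (mul_ne_zero two_ne_zero hy)]

/-- The very-well-poised part of the factor has a nonzero limit. -/
lemma exists_tendsto_br_sf {X : Type*} [TopologicalSpace X] {τ : ℂ} (hτ : 0 < τ.im)
    {η c d : X → ℂ} {p : X} {s : Set X} (hη : ContinuousAt η p) (hc : ContinuousAt c p)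
    (hd : ContinuousAt d p) {N l : ℕ} (hl : l ≤ N)
    (hcd : ∀ j : ℤ, 1 - (N : ℤ) ≤ j → j ≤ N - 1 → theta τ (c p - d p + 2 * j * η p) ≠ 0)
    (hs : ∀ᶠ y in 𝓝[s] p, η y ≠ 0 ∧ br τ (η y) (spec (η y) N (c y) (d y)) ≠ 0 ∧
      (l = N → br τ (η y) (spec (η y) N (c y) (d y) + 2 * l) ≠ 0)) :
    ∃ L : ℂ, L ≠ 0 ∧ Tendsto (fun y => br τ (η y) (spec (η y) N (c y) (d y) + 2 * l)
      / br τ (η y) (spec (η y) N (c y) (d y)) * (sf τ (η y) (spec (η y) N (c y) (d y)) l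
        / sf τ (η y) (spec (η y) N (c y) (d y) + N + 1) l)) (𝓝[s] p) (𝓝 L) := by
  rcases l with _ | l
  · refine ⟨1, one_ne_zero, tendsto_const_nhds.congr' ?_⟩
    filter_upwards [hs] with y hy
    simp [sf, hy.2.1]
  have hF : ∀ (i : ℤ) (n : ℕ), 1 - (N : ℤ) ≤ i → i + n ≤ N →
      thetaFact τ (2 * η p) (c p - d p + 2 * i * η p) n ≠ 0 := fun i n h1 h2 =>
    thetaFact_ne_zero fun j hj => by
      convert hcd (i + j) (by omega) (by omega) using 2
      push_cast; ring
  have hFc : ∀ (i : ℤ) (n : ℕ), ContinuousAt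
      (fun y => thetaFact τ (2 * η y) (c y - d y + 2 * i * η y) n) p := fun i n =>
    continuousAt_thetaFact hτ (by fun_prop) (by fun_prop) n
  have e1 : ∀ y, η y ≠ 0 → br τ (η y) (spec (η y) N (c y) (d y) + 2 * (l + 1 : ℕ))
      = theta τ (c y - d y + 2 * (2 * (l + 1) - N : ℤ) * η y) := fun y hy => by
    rw [br]; congr 1; push_cast; linear_combination two_mul_eta_mul_spec hy N (c y) (d y)
  have e2 : ∀ y, η y ≠ 0 → sf τ (η y) (spec (η y) N (c y) (d y)) (l + 1)
      = br τ (η y) (spec (η y) N (c y) (d y))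
        * thetaFact τ (2 * η y) (c y - d y + 2 * (1 - N : ℤ) * η y) l := fun y hy => by
    rw [sf_eq_thetaFact, thetaFact_succ', br]
    congr 2; push_cast; linear_combination two_mul_eta_mul_spec hy N (c y) (d y)
  have e3 : ∀ y, η y ≠ 0 → ∀ n, sf τ (η y) (spec (η y) N (c y) (d y) + N + 1) n
      = thetaFact τ (2 * η y) (c y - d y + 2 * (1 : ℤ) * η y) n := fun y hy n => by
    rw [sf_eq_thetaFact]
    congr 1; push_cast; linear_combination two_mul_eta_mul_spec hy N (c y) (d y)
  have key : ∀ t B F G : ℂ, t ≠ 0 → B ≠ 0 → F / G = t / B * (B * F / (G * t)) := by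
    intro t B F G ht hB
    field_simp
  by_cases hlN : l + 1 = N
  · refine ⟨thetaFact τ (2 * η p) (c p - d p + 2 * (1 - N : ℤ) * η p) l
      / thetaFact τ (2 * η p) (c p - d p + 2 * (1 : ℤ) * η p) l,
      div_ne_zero (hF _ _ (by omega) (by omega)) (hF _ _ (by omega) (by omega)),
      (((hFc _ _).div (hFc _ _) (hF _ _ (by omega) (by omega))).tendsto.mono_left
        nhdsWithin_le_nhds).congr' ?_⟩
    filter_upwards [hs] with y ⟨hy0, hy1, hy2⟩
    have hy2 := hy2 hlN
    have e4 : theta τ (c y - d y + 2 * (1 : ℤ) * η y + l * (2 * η y))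
        = theta τ (c y - d y + 2 * (2 * (l + 1) - N : ℤ) * η y) := by
      congr 1; rw [← hlN]; push_cast; ring
    rw [e1 y hy0] at hy2
    rw [e1 y hy0, e2 y hy0, e3 y hy0, thetaFact_succ, e4, Pi.div_apply]
    exact key _ _ _ _ hy2 hy1
  · have hθ : ContinuousAt (fun y => theta τ (c y - d y + 2 * (2 * (l + 1) - N : ℤ) * η y)) p :=
      continuousAt_theta_comp hτ (by fun_prop)
    refine ⟨theta τ (c p - d p + 2 * (2 * (l + 1) - N : ℤ) * η p)
      * thetaFact τ (2 * η p) (c p - d p + 2 * (1 - N : ℤ) * η p) l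
      / thetaFact τ (2 * η p) (c p - d p + 2 * (1 : ℤ) * η p) (l + 1),
      div_ne_zero (mul_ne_zero (hcd _ (by omega) (by omega)) (hF _ _ (by omega) (by omega)))
        (hF _ _ (by omega) (by push_cast; omega)),
      (((hθ.mul (hFc _ _)).div (hFc _ _)
        (hF _ _ (by omega) (by push_cast; omega))).tendsto.mono_left nhdsWithin_le_nhds).congr' ?_⟩
    filter_upwards [hs] with y ⟨hy0, hy1, _⟩
    rw [e1 y hy0, e2 y hy0, e3 y hy0, Pi.div_apply]
    simp only [Pi.mul_apply]
    field_simp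

lemma exists_tendsto_sideFactor {X : Type*} [TopologicalSpace X] {τ : ℂ} (hτ : 0 < τ.im)
    {η c d : X → ℂ} {p : X} {s : Set X} (hη : ContinuousAt η p) (hc : ContinuousAt c p)
    (hd : ContinuousAt d p) {N l : ℕ} (hl : l ≤ N) (hcd : BasisCondition τ (η p) N (c p) (d p))
    (h0 : η p = 0 ∨ ∀ j : ℤ, j ≠ 0 → |j| ≤ N → 2 * j * η p ∉ lattice τ)
    (hs : ∀ᶠ y in 𝓝[s] p, η y ≠ 0 ∧ br τ (η y) (spec (η y) N (c y) (d y)) ≠ 0 ∧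
      (l = N → br τ (η y) (spec (η y) N (c y) (d y) + 2 * l) ≠ 0)) :
    ∃ L : ℂ, L ≠ 0 ∧
      Tendsto (fun y => sideFactor τ (η y) N (c y) (d y) l) (𝓝[s] p) (𝓝 L) := by
  have hcd1 : ∀ j : ℤ, 1 - (N : ℤ) ≤ j → j ≤ N - 1 → theta τ (c p - d p + 2 * j * η p) ≠ 0 :=
    fun j h1 h2 => theta_ne_zero hτ (hcd.1 j h1 h2)
  obtain ⟨L₁, hL₁, h1⟩ := exists_tendsto_br_sf hτ hη hc hd hl hcd1 hs
  obtain ⟨L₂, hL₂, h2⟩ := exists_tendsto_sf_div_sf hτ hη hl h0 (hs.mono fun _ h => h.1)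
  have h3 : thetaFact τ (2 * η p) (c p - d p + 2 * (1 - N : ℤ) * η p) N
      * thetaFact τ (2 * η p) (c p + d p) N ≠ 0 := by
    refine mul_ne_zero (thetaFact_ne_zero fun j hj => ?_) (thetaFact_ne_zero fun j hj => ?_)
    · convert hcd1 (1 - N + j) (by omega) (by omega) using 2
      push_cast; ring
    · convert theta_ne_zero hτ (hcd.2 j hj) using 2
      ring
  have h4 : ContinuousAt (fun y => thetaFact τ (2 * η y) (c y - d y + 2 * (1 - N : ℤ) * η y) N
      * thetaFact τ (2 * η y) (c y + d y) N) p :=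
    (continuousAt_thetaFact hτ (by fun_prop) (by fun_prop) N).mul
      (continuousAt_thetaFact hτ (by fun_prop) (by fun_prop) N)
  refine ⟨_, div_ne_zero (mul_ne_zero hL₁ hL₂) h3,
    ((h1.mul h2).div (h4.tendsto.mono_left nhdsWithin_le_nhds) h3).congr' ?_⟩
  filter_upwards [hs] with y hy
  have e1 : sf τ (η y) (spec (η y) N (c y) (d y) + 1) N
      = thetaFact τ (2 * η y) (c y - d y + 2 * (1 - N : ℤ) * η y) N := by
    rw [sf_eq_thetaFact]
    congr 1; push_cast; linear_combination two_mul_eta_mul_spec hy.1 N (c y) (d y)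
  have e2 : sf τ (η y) ((c y + d y) / (2 * η y)) N = thetaFact τ (2 * η y) (c y + d y) N := by
    rw [sf_eq_thetaFact, mul_div_cancel₀ _ (mul_ne_zero two_ne_zero hy.1)]
  rw [sideFactor, e1, e2]
  simp only [Pi.div_apply, div_eq_mul_inv, mul_inv]
  ring

lemma two_mul_int_mul_notMem_lattice {τ η : ℂ} (hτ_re : τ.re = 0) (hτ_im : 0 < τ.im) {N : ℕ}
    (h : η ∈ realRange N ∪ imagRange τ N) (h0 : η ≠ 0) (j : ℤ) (hj : j ≠ 0) (hjN : |j| ≤ N) :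
    2 * j * η ∉ lattice τ := by
  rintro ⟨m, n, hmn⟩
  have hre := congrArg Complex.re hmn
  have him := congrArg Complex.im hmn
  simp [hτ_re] at hre him
  have hN : (0 : ℝ) < 2 * ((N : ℝ) + 1) := by positivity
  have hj' : |(j : ℝ)| ≤ N := by exact_mod_cast hjN
  have hj0 : (j : ℝ) ≠ 0 := Int.cast_ne_zero.2 hj
  have bound : ∀ {x C : ℝ}, 0 < C → |x| < C / (2 * ((N : ℝ) + 1)) → |2 * j * x| < C := by
    intro x C hC hx
    rw [lt_div_iff₀ hN] at hx
    rw [abs_mul, abs_mul, abs_two]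
    have := mul_le_mul_of_nonneg_right hj' (abs_nonneg x)
    nlinarith [abs_nonneg x]
  rcases h with ⟨h1, h2⟩ | ⟨h1, h2⟩
  · have h3 := bound one_pos ((Complex.abs_re_le_norm η).trans_lt h2)
    rw [hre] at h3
    have : m = 0 := by
      have h4 : |m| < 1 := by exact_mod_cast h3
      exact Int.abs_lt_one_iff.1 h4
    rw [this, Int.cast_zero] at hre
    have : η.re = 0 := by simpa [hj0, hj] using hre
    exact h0 (Complex.ext this h1)
  · have h3 := bound hτ_im ((Complex.abs_im_le_norm η).trans_lt h2)
    rw [him, abs_mul, abs_of_pos hτ_im] at h3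
    have : n = 0 := by
      have h4 : |(n : ℝ)| < 1 := by
        by_contra h5
        nlinarith [mul_le_mul_of_nonneg_right (not_lt.1 h5) hτ_im.le]
      have h4 : |n| < 1 := by exact_mod_cast h4
      exact Int.abs_lt_one_iff.1 h4
    rw [this, Int.cast_zero, zero_mul] at him
    have : η.im = 0 := by simpa [hj0, hj] using him
    exact h0 (Complex.ext h1 this)

theorem exists_tendsto_dualFactor {τ η a b c d : ℂ} (hτ_re : τ.re = 0) (hτ : 0 < τ.im) {N k l : ℕ}
    (hk : k ≤ N) (hl : l ≤ N) (hab : BasisCondition τ η N a b) (hcd : BasisCondition τ η N c d)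
    (hη : η ∈ realRange N ∪ imagRange τ N) :
    ∃ Φ : ℂ, Tendsto (fun P : ℂ × ℂ × ℂ × ℂ × ℂ =>
        dualFactor τ N k l P.1 P.2.1 P.2.2.1 P.2.2.2.1 P.2.2.2.2)
      (𝓝[regularSet τ N k l] (η, a, b, c, d)) (𝓝 Φ) := by
  have h0 : η = 0 ∨ ∀ j : ℤ, j ≠ 0 → |j| ≤ N → 2 * j * η ∉ lattice τ :=
    or_iff_not_imp_left.2 fun h => two_mul_int_mul_notMem_lattice hτ_re hτ hη h
  obtain ⟨L, _, h1⟩ := exists_tendsto_sideFactor (p := (η, a, b, c, d))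
    (s := regularSet τ N k l) (η := fun P => P.1) (c := fun P => P.2.2.2.1)
    (d := fun P => P.2.2.2.2) hτ (by fun_prop) (by fun_prop) (by fun_prop) hl hcd h0 (by
      filter_upwards [self_mem_nhdsWithin] with P ⟨hP0, hP⟩
      simp only [dualDenominator, mul_ne_zero_iff] at hP
      obtain ⟨⟨⟨⟨⟨_, _⟩, h3⟩, _, h5⟩, _⟩, _, _⟩ := hP
      refine ⟨hP0, h3, fun hlN => ?_⟩
      subst hlN
      rcases l with _ | l
      · simpa using h3
      · convert Finset.prod_ne_zero_iff.1 h5 l (by simp) using 2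
        push_cast
        ring)
  obtain ⟨M, hM, h2⟩ := exists_tendsto_sideFactor (p := (η, a, b, c, d))
    (s := regularSet τ N k l) (η := fun P => P.1) (c := fun P => P.2.1)
    (d := fun P => P.2.2.1) hτ (by fun_prop) (by fun_prop) (by fun_prop) hk hab h0 (by
      filter_upwards [self_mem_nhdsWithin] with P ⟨hP0, hP⟩
      simp only [dualDenominator, mul_ne_zero_iff] at hP
      obtain ⟨⟨⟨⟨⟨_, _⟩, _⟩, _, _⟩, h6⟩, _, h8⟩ := hP
      refine ⟨hP0, ?_, fun _ => h6⟩
      rcases k with _ | k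
      · simpa using h6
      · simpa using Finset.prod_ne_zero_iff.1 h8 0 (by simp))
  refine ⟨L / M, ?_⟩
  simp only [dualFactor_eq_div]
  exact h1.div h2 hM

lemma BasisCondition.dual {τ η a b : ℂ} {N : ℕ} (h : BasisCondition τ η N a b) :
    BasisCondition τ η N (η * (1 - N) - b) (η * (1 - N) - a) := by
  refine ⟨fun j h1 h2 => ?_, fun j hj hmem => ?_⟩
  · have := h.1 j h1 h2
    rwa [show η * (1 - N) - b - (η * (1 - N) - a) = a - b by ring]
  · refine h.2 (N - 1 - j) (by omega) ?_
    obtain ⟨m, n, hmn⟩ := hmem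
    refine ⟨-m, -n, ?_⟩
    have : ((N - 1 - j : ℕ) : ℂ) = N - 1 - j := by
      rw [Nat.cast_sub (by omega), Nat.cast_sub (by omega), Nat.cast_one]
    rw [this]
    push_cast
    linear_combination -hmn

end EllipticSixJ

end

theorem mainTheorem7 (τ : ℂ) (hτ_re : τ.re = 0) (hτ_im : 0 < τ.im)
    (η : ℂ) (hη : η.im = 0 ∨ η.re = 0) (N : ℕ) (a b c d : ℂ)
    (hab : EllipticSixJ.BasisCondition τ η N a b)
    (hcd : EllipticSixJ.BasisCondition τ η N c d) :
    -- the coefficients on the left-hand side are well defined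
    (∀ k : Fin (N + 1),
      EllipticSixJ.IsExpansion τ η N a b c d k (EllipticSixJ.R τ η N a b c d k) ∧
      ∀ r, EllipticSixJ.IsExpansion τ η N a b c d k r → r = EllipticSixJ.R τ η N a b c d k) ∧
    -- so are those on the right-hand side
    (∀ l : Fin (N + 1),
      EllipticSixJ.IsExpansion τ η N (η * (1 - N) - d) (η * (1 - N) - c)
          (η * (1 - N) - b) (η * (1 - N) - a) l
        (EllipticSixJ.R τ η N (η * (1 - N) - d) (η * (1 - N) - c)
          (η * (1 - N) - b) (η * (1 - N) - a) l) ∧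
      ∀ r, EllipticSixJ.IsExpansion τ η N (η * (1 - N) - d) (η * (1 - N) - c)
          (η * (1 - N) - b) (η * (1 - N) - a) l r →
        r = EllipticSixJ.R τ η N (η * (1 - N) - d) (η * (1 - N) - c)
          (η * (1 - N) - b) (η * (1 - N) - a) l) ∧
    -- self-duality, whenever no denominator of the factor vanishes
    (∀ k l : Fin (N + 1), (η, a, b, c, d) ∈ EllipticSixJ.regularSet τ N k l →
      EllipticSixJ.R τ η N a b c d k l =
        EllipticSixJ.dualFactor τ N k l η a b c d *
          EllipticSixJ.R τ η N (η * (1 - N) - d) (η * (1 - N) - c)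
            (η * (1 - N) - b) (η * (1 - N) - a) l k) ∧
    -- self-duality without exception for `η` in the two ranges, the factor being extended by
    -- continuity across its removable singularities (among them `η = 0`)
    (η ∈ EllipticSixJ.realRange N ∪ EllipticSixJ.imagRange τ N →
      ∀ k l : Fin (N + 1),
        (η, a, b, c, d) ∈ closure (EllipticSixJ.regularSet τ N k l) ∧
        ∃ Φ : ℂ,
          Tendsto (fun P : ℂ × ℂ × ℂ × ℂ × ℂ =>
              EllipticSixJ.dualFactor τ N k l P.1 P.2.1 P.2.2.1 P.2.2.2.1 P.2.2.2.2)
            (𝓝[EllipticSixJ.regularSet τ N k l] (η, a, b, c, d)) (𝓝 Φ) ∧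
          EllipticSixJ.R τ η N a b c d k l =
            Φ * EllipticSixJ.R τ η N (η * (1 - N) - d) (η * (1 - N) - c)
              (η * (1 - N) - b) (η * (1 - N) - a) l k) := by
  have hab' := hab.dual
  have nab' := hab'.nondegenerate hτ_im
  have ncd := hcd.nondegenerate hτ_im
  refine ⟨fun k => ?_, fun l => ?_, fun k l hP => ?_, fun hη' k l => ⟨?_, ?_⟩⟩
  · have h := EllipticSixJ.isExpansion_R hτ_im ncd a b k
    exact ⟨h, fun r hr => hr.unique hτ_im ncd h⟩
  · have h := EllipticSixJ.isExpansion_R hτ_im nab' (η * (1 - N) - d) (η * (1 - N) - c) l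
    exact ⟨h, fun r hr => hr.unique hτ_im nab' h⟩
  · exact EllipticSixJ.R_eq_mul_of_tendsto hτ_im nab' ncd k l
      ((EllipticSixJ.continuousAt_dualFactor hτ_im hP).tendsto.mono_left nhdsWithin_le_nhds)
  · exact closure_mono (EllipticSixJ.genericSet_subset_regularSet hτ_im (Nat.lt_succ_iff.1 k.2))
      (EllipticSixJ.dense_genericSet hτ_im _)
  · obtain ⟨Φ, hΦ⟩ := EllipticSixJ.exists_tendsto_dualFactor hτ_re hτ_im
      (Nat.lt_succ_iff.1 k.2) (Nat.lt_succ_iff.1 l.2) hab hcd hη'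
    exact ⟨Φ, hΦ, EllipticSixJ.R_eq_mul_of_tendsto hτ_im nab' ncd k l hΦ⟩
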